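/- Manifolds, vector bundles and maps are real and $C^\infty$; manifolds are finite-dimensional, Hausdorff and paracompact. Let $\tau:E\to M$ be a vector bundle of finite rank with a Lie algebroid structure $([\![\cdot,\cdot]\!],\rho)$, that is, a Lie bracket on $\Gamma(E)$ and a vector bundle map $\rho:E\to TM$ over the identity with $[\![X,fY]\!]=f[\![X,Y]\!]+\rho(X)(f)\,Y$ for $X,Y\in\Gamma(E)$, $f\in C^\infty(M)$. Let $\tau^*:E^*\to M$ be the dual bundle and $L:E\to\mathbb R$ a smooth function. For $f:M'\to M$ equal to $\tau$ or $\tau^*$, the prolongation $\mathcal L^fE\to M'$ is the vector bundle with fibres $(\mathcal L^fE)_{x'}=\{(b,v)\in E_{f(x')}\times T_{x'}M' : \rho(b)=(T_{x'}f)(v)\}$. Its sections are the pairs $(\sigma,X')$ of a section $\sigma$ of $f^*E$ and a vector field $X'$ on $M'$ with $\rho(\sigma(x'))=(T_{x'}f)(X'(x'))$ for all $x'\in M'$. It is a Lie algebroid with anchor $\rho^f(\sigma,X')=X'$ and the bracket given, when $\sigma=\sum_i h_i(X_i\circ f)$ and $\gamma=\sum_j s_j(Y_j\circ f)$ (locally)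 with $h_i,s_j\in C^\infty(M')$ and $X_i,Y_j\in\Gamma(E)$, by $$[\![(\sigma,X'),(\gamma,Y')]\!]^f=\Big(\sum_{i,j}h_is_j\,([\![X_i,Y_j]\!]\circ f)+\sum_jX'(s_j)\,(Y_j\circ f)-\sum_iY'(h_i)\,(X_i\circ f),\ [X',Y']\Big).$$ Its differential $d:\Gamma(\wedge^k(\mathcal L^fE)^*)\to\Gamma(\wedge^{k+1}(\mathcal L^fE)^*)$ is $$d\mu(Z_0,\dots,Z_k)=\sum_i(-1)^i\rho^f(Z_i)\big(\mu(Z_0,\dots,\widehat{Z_i},\dots,Z_k)\big)+\sum_{i<j}(-1)^{i+j}\mu([\![Z_i,Z_j]\!]^f,Z_0,\dots,\widehat{Z_i},\dots,\widehat{Z_j},\dots,Z_k).$$ For $a,b$ in the same fibre of $E$ let $b_a^v\in T_aE$ be the velocity at $t=0$ of $t\mapsto a+tb$, and let $S$ be the vertical endomorphism of $\mathcal L^\tau E$, $S_a(b,v)=(0,b_a^v)$. Define $\theta_L\in\Gamma((\mathcal L^\tau E)^*)$ by $\theta_L(a)(z)=\rho^\tau(S_az)(L)$ and $\omega_L=-d\theta_L$;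 define $\lambda_E\in\Gamma((\mathcal L^{\tau^*}E)^*)$ by $\lambda_E(a^*)(b,v)=a^*(b)$ and $\Omega_E=-d\lambda_E$. The Legendre transformation $Leg_L:E\to E^*$ is the smooth map over the identity of $M$ with $Leg_L(a)(b)=\theta_L(a)(z)$ for every $z\in(\mathcal L^\tau E)_a$ whose first component is $b$ (equivalently, $Leg_L(a)(b)=b_a^v(L)$), and $\mathcal LLeg_L:\mathcal L^\tau E\to\mathcal L^{\tau^*}E$ is the map over $Leg_L$ given by $\mathcal LLeg_L(b,X_a)=(b,(T_aLeg_L)(X_a))$. **Theorem.** The pair $(\mathcal LLeg_L,Leg_L)$ is a morphism between the Lie algebroids $\mathcal L^\tau E$ and $\mathcal L^{\tau^*}E$: it is a morphism of vector bundles and, for every $k\ge 0$ and every $\mu\in\Gamma(\wedge^k(\mathcal L^{\tau^*}E)^*)$, $$d^{\mathcal L^\tau E}\big((\mathcal LLeg_L,Leg_L)^*\mu\big)=(\mathcal LLeg_L,Leg_L)^*\big(d^{\mathcal L^{\tau^*}E}\mu\big).$$ Moreover, $$(\mathcal LLeg_L,Leg_L)^*\lambda_E=\theta_L,\qquad(\mathcal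 LLeg_L,Leg_L)^*\Omega_E=\omega_L.$$ -/

import Mathlib

open Bundle Manifold Topology
open scoped ContDiff

set_option linter.unusedSectionVars false

noncomputable section

namespace LieAlgd

/-- The derivative `v(g)` of a real function `g` on a manifold in the direction of a tangent
vector `v` at `x`. -/
def dirDeriv {EM : Type*} [NormedAddCommGroup EM] [NormedSpace ℝ EM]
    {H : Type*} [TopologicalSpace H] (I : ModelWithCorners ℝ EM H)
    {M : Type*} [TopologicalSpace M] [ChartedSpace H M]
    (g : M → ℝ) (x : M) (v : TangentSpace I x) : ℝ :=
  mfderiv I 𝓘(ℝ, ℝ) g x v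

section Basic

variable {EM : Type*} [NormedAddCommGroup EM] [NormedSpace ℝ EM]
  {H : Type*} [TopologicalSpace H] (I : ModelWithCorners ℝ EM H)
  {M : Type*} [TopologicalSpace M] [ChartedSpace H M]
  (F : Type*) [NormedAddCommGroup F] [NormedSpace ℝ F]
  (E : M → Type*) [∀ x, AddCommGroup (E x)] [∀ x, Module ℝ (E x)]
  [∀ x, TopologicalSpace (E x)] [TopologicalSpace (TotalSpace F E)]
  [FiberBundle F E] [VectorBundle ℝ F E]

/-- A Lie algebroid structure on a smooth real vector bundle `E` over `M`: a smooth bundle map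
`ρ : E → TM` (the anchor) and a Lie bracket on the space of smooth sections of `E` with
`⟦X, f Y⟧ = f ⟦X, Y⟧ + ρ(X)(f) Y`. -/
structure LieAlgebroid [IsManifold I ∞ M] [ContMDiffVectorBundle ∞ F E I] where
  /-- the anchor map -/
  anchor : ∀ x : M, E x →L[ℝ] TangentSpace I x
  contMDiff_anchor : ContMDiff (I.prod 𝓘(ℝ, F)) I.tangent ∞
    (fun a : TotalSpace F E => (⟨a.proj, anchor a.proj a.snd⟩ : TangentBundle I M))
  /-- the bracket of sections -/
  bracket : Cₛ^∞⟮I; F, E⟯ →ₗ[ℝ] Cₛ^∞⟮I; F, E⟯ →ₗ[ℝ] Cₛ^∞⟮I; F, E⟯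
  bracket_self : ∀ X, bracket X X = 0
  jacobi : ∀ X Y Z, bracket X (bracket Y Z) + bracket Y (bracket Z X) + bracket Z (bracket X Y) = 0
  leibniz : ∀ (X Y fY : Cₛ^∞⟮I; F, E⟯) (f : C^∞⟮I, M; 𝓘(ℝ, ℝ), ℝ⟯), (∀ x, fY x = f x • Y x) →
    ∀ x, bracket X fY x =
      f x • bracket X Y x + dirDeriv I f x (anchor x (X x)) • Y x

end Basic

section Prolongation

variable {EM : Type*} [NormedAddCommGroup EM] [NormedSpace ℝ EM]
  {H : Type*} [TopologicalSpace H] {I : ModelWithCorners ℝ EM H}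
  {M : Type*} [TopologicalSpace M] [ChartedSpace H M] [IsManifold I ∞ M]
  {F : Type*} [NormedAddCommGroup F] [NormedSpace ℝ F]
  {E : M → Type*} [∀ x, AddCommGroup (E x)] [∀ x, Module ℝ (E x)]
  [∀ x, TopologicalSpace (E x)] [TopologicalSpace (TotalSpace F E)]
  [FiberBundle F E] [VectorBundle ℝ F E] [ContMDiffVectorBundle ∞ F E I]
  {EM' : Type*} [NormedAddCommGroup EM'] [NormedSpace ℝ EM']
  {H' : Type*} [TopologicalSpace H'] (I' : ModelWithCorners ℝ EM' H')
  {M' : Type*} [TopologicalSpace M'] [ChartedSpace H' M'] [IsManifold I' ∞ M']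
  (A : LieAlgebroid I F E) (f : M' → M)

/-- The fibre over `x'` of the prolongation `𝓛^f E` of the Lie algebroid `E` over a smooth map
`f : M' → M`: the pairs `(b, v')` with `b ∈ E_{f(x')}`, `v' ∈ T_{x'}M'` and
`ρ(b) = (T_{x'} f)(v')`. -/
def prolongFiber (x' : M') : Submodule ℝ (E (f x') × TangentSpace I' x') where
  carrier := {z | A.anchor (f x') z.1 = mfderiv I' I f x' z.2}
  add_mem' := by
    intro z w hz hw
    simp only [Set.mem_ofPred_eq, Prod.fst_add, Prod.snd_add, map_add] at *
    rw [hz, hw]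
  zero_mem' := by simp
  smul_mem' := by
    intro c z hz
    simp only [Set.mem_ofPred_eq, Prod.smul_fst, Prod.smul_snd, map_smul] at *
    rw [hz]

/-- A smooth section of `𝓛^f E`: a pair `(σ, X')` of a smooth section `σ` of `f^* E` and a smooth
vector field `X'` on `M'` with `ρ(σ(x')) = (T_{x'} f)(X'(x'))`. -/
structure ProlongSection where
  /-- the component in `f^* E` -/
  fst : ∀ x' : M', E (f x')
  /-- the vector field on `M'`; this is also the image of the section under the anchor of
  `𝓛^f E` -/
  snd : ∀ x' : M', TangentSpace I' x'
  contMDiff_fst : ContMDiff I' (I.prod 𝓘(ℝ, F)) ∞ (fun x' => (⟨f x', fst x'⟩ : TotalSpace F E))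
  contMDiff_snd : ContMDiff I' I'.tangent ∞ (fun x' => (⟨x', snd x'⟩ : TangentBundle I' M'))
  compat : ∀ x', A.anchor (f x') (fst x') = mfderiv I' I f x' (snd x')

variable {I' A f}

/-- The value of a section at a point. -/
def ProlongSection.eval (X : ProlongSection I' A f) (x' : M') : prolongFiber I' A f x' :=
  ⟨(X.fst x', X.snd x'), X.compat x'⟩

/-- `C` is the bracket of the sections `X = (∑ᵢ hᵢ (Xᵢ ∘ f), X')` and `Y = (∑ⱼ sⱼ (Yⱼ ∘ f), Y')`
of `𝓛^f E`:
`C = (∑ᵢⱼ hᵢ sⱼ (⟦Xᵢ, Yⱼ⟧ ∘ f) + ∑ⱼ X'(sⱼ) (Yⱼ ∘ f) - ∑ᵢ Y'(hᵢ) (Xᵢ ∘ f), [X', Y'])`.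
The formula is required at every point and for all representations of the two first components
near that point, by smooth functions on `M'` and smooth sections of `E`. -/
def IsProlongBracket (X Y C : ProlongSection I' A f) : Prop :=
  (∀ x', C.snd x' = VectorField.mlieBracket I' X.snd Y.snd x') ∧
  ∀ (x' : M') (p q : ℕ)
    (h : Fin p → C^∞⟮I', M'; 𝓘(ℝ, ℝ), ℝ⟯) (Xs : Fin p → Cₛ^∞⟮I; F, E⟯)
    (s : Fin q → C^∞⟮I', M'; 𝓘(ℝ, ℝ), ℝ⟯) (Ys : Fin q → Cₛ^∞⟮I; F, E⟯),
    (∀ᶠ y in 𝓝 x', X.fst y = ∑ i, h i y • Xs i (f y)) →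
    (∀ᶠ y in 𝓝 x', Y.fst y = ∑ j, s j y • Ys j (f y)) →
    C.fst x' = ∑ i, ∑ j, (h i x' * s j x') • A.bracket (Xs i) (Ys j) (f x')
      + ∑ j, dirDeriv I' (s j) x' (X.snd x') • Ys j (f x')
      - ∑ i, dirDeriv I' (h i) x' (Y.snd x') • Xs i (f x')

/-- The bracket of sections of `𝓛^f E`: the unique section `C` with `IsProlongBracket X Y C`
(locally, every section of `f^* E` is a combination `∑ᵢ hᵢ (Xᵢ ∘ f)`, and the formula does not
depend on the combination chosen). -/
def prolongBracket (X Y : ProlongSection I' A f) : ProlongSection I' A f :=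
  haveI : Nonempty (ProlongSection I' A f) := ⟨X⟩
  Classical.epsilon (IsProlongBracket X Y)

variable (I' A f) in
/-- Families of real-valued functions of `k` vectors on the fibres of `𝓛^f E`. -/
abbrev Cochain (k : ℕ) : Type _ := ∀ x' : M', (Fin k → prolongFiber I' A f x') → ℝ

/-- `μ` is a smooth section of `⋀^k (𝓛^f E)^*`: it is alternating and multilinear on every fibre
and has smooth values on smooth sections. -/
def IsForm {k : ℕ} (μ : Cochain I' A f k) : Prop :=
  (∀ x', ∃ m : prolongFiber I' A f x' [⋀^Fin k]→ₗ[ℝ] ℝ, ∀ a, μ x' a = m a) ∧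
  ∀ X : Fin k → ProlongSection I' A f,
    ContMDiff I' 𝓘(ℝ, ℝ) ∞ (fun x' => μ x' (fun i => (X i).eval x'))

/-- The right-hand side of the formula for the differential,
`∑ᵢ (-1)^i ρ(Xᵢ)(μ(X₀, …, X̂ᵢ, …, X_k)) + ∑_{i<j} (-1)^(i+j) μ(⟦Xᵢ, Xⱼ⟧, X₀, …, X̂ᵢ, …, X̂ⱼ, …, X_k)`.
The pairs `i < j` are listed as `(i, j + 1)` with `i ≤ j`. -/
def koszul : {k : ℕ} → Cochain I' A f k → (Fin (k + 1) → ProlongSection I' A f) → M' → ℝ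
  | 0, μ, X, x' =>
      dirDeriv I' (fun y => μ y Fin.elim0) x' ((X 0).snd x')
  | k + 1, μ, X, x' =>
      ∑ i : Fin (k + 2), (-1 : ℝ) ^ (i : ℕ) *
        dirDeriv I' (fun y => μ y (fun l => (i.removeNth X l).eval y)) x' ((X i).snd x')
      + ∑ i : Fin (k + 1), ∑ j : Fin (k + 1), if i ≤ j then
          (-1 : ℝ) ^ ((i : ℕ) + ((j : ℕ) + 1)) *
            μ x' (fun l => (Fin.cons (prolongBracket (X i.castSucc) (X j.succ))
              (j.removeNth (i.castSucc.removeNth X)) :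
                Fin (k + 1) → ProlongSection I' A f) l |>.eval x')
        else 0

/-- The differential `d^{𝓛^f E}`: for a form `μ`, `dμ` is the unique family with
`dμ(X₀, …, X_k) = koszul μ X₀ … X_k` for all smooth sections `X₀, …, X_k` (the right-hand side at
a point depends only on the values of the `Xᵢ` at that point). -/
def differential {k : ℕ} (μ : Cochain I' A f k) : Cochain I' A f (k + 1) :=
  Classical.epsilon fun ν : Cochain I' A f (k + 1) =>
    ∀ (X : Fin (k + 1) → ProlongSection I' A f) (x' : M'),
      ν x' (fun i => (X i).eval x') = koszul μ X x'

end Prolongation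

section Morphism

variable {EM : Type*} [NormedAddCommGroup EM] [NormedSpace ℝ EM]
  {H : Type*} [TopologicalSpace H] {I : ModelWithCorners ℝ EM H}
  {M : Type*} [TopologicalSpace M] [ChartedSpace H M] [IsManifold I ∞ M]
  {F : Type*} [NormedAddCommGroup F] [NormedSpace ℝ F]
  {E : M → Type*} [∀ x, AddCommGroup (E x)] [∀ x, Module ℝ (E x)]
  [∀ x, TopologicalSpace (E x)] [TopologicalSpace (TotalSpace F E)]
  [FiberBundle F E] [VectorBundle ℝ F E] [ContMDiffVectorBundle ∞ F E I]
  {E₁ : Type*} [NormedAddCommGroup E₁] [NormedSpace ℝ E₁]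
  {H₁ : Type*} [TopologicalSpace H₁] {I₁ : ModelWithCorners ℝ E₁ H₁}
  {M₁ : Type*} [TopologicalSpace M₁] [ChartedSpace H₁ M₁] [IsManifold I₁ ∞ M₁]
  {E₂ : Type*} [NormedAddCommGroup E₂] [NormedSpace ℝ E₂]
  {H₂ : Type*} [TopologicalSpace H₂] {I₂ : ModelWithCorners ℝ E₂ H₂}
  {M₂ : Type*} [TopologicalSpace M₂] [ChartedSpace H₂ M₂] [IsManifold I₂ ∞ M₂]
  {A : LieAlgebroid I F E} {f₁ : M₁ → M} {f₂ : M₂ → M}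
  (φ : M₁ → M₂) (Φ : ∀ x, prolongFiber I₁ A f₁ x →ₗ[ℝ] prolongFiber I₂ A f₂ (φ x))

/-- The pull-back `(Φ, φ)^* μ`, for a fibrewise linear map `Φ : 𝓛^{f₁} E → 𝓛^{f₂} E` over `φ`. -/
def pullback {k : ℕ} (μ : Cochain I₂ A f₂ k) : Cochain I₁ A f₁ k :=
  fun x a => μ (φ x) (fun i => Φ x (a i))

/-- `(Φ, φ)` is a morphism between the Lie algebroids `𝓛^{f₁} E` and `𝓛^{f₂} E`: a smooth morphism
of vector bundles (`φ` is smooth, and the fibrewise linear map `Φ` takes smooth sections to smooth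
sections along `φ`) whose pull-back commutes with the differentials on `Γ(⋀^k (𝓛^{f₂} E)^*)`, for
every `k`. -/
structure IsLieAlgebroidMorphism : Prop where
  contMDiff_base : ContMDiff I₁ I₂ ∞ φ
  contMDiff_fst : ∀ X : ProlongSection I₁ A f₁, ContMDiff I₁ (I.prod 𝓘(ℝ, F)) ∞
    (fun x => (⟨f₂ (φ x), (Φ x (X.eval x)).1.1⟩ : TotalSpace F E))
  contMDiff_snd : ∀ X : ProlongSection I₁ A f₁, ContMDiff I₁ I₂.tangent ∞
    (fun x => (⟨φ x, (Φ x (X.eval x)).1.2⟩ : TangentBundle I₂ M₂))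
  differential_pullback : ∀ (k : ℕ) (μ : Cochain I₂ A f₂ k), IsForm μ →
    differential (pullback φ Φ μ) = pullback φ Φ (differential μ)

end Morphism

section Lagrangian

variable {EM : Type*} [NormedAddCommGroup EM] [NormedSpace ℝ EM]
  {H : Type*} [TopologicalSpace H] {I : ModelWithCorners ℝ EM H}
  {M : Type*} [TopologicalSpace M] [ChartedSpace H M] [IsManifold I ∞ M]
  {F : Type*} [NormedAddCommGroup F] [NormedSpace ℝ F]
  {E : M → Type*} [∀ x, AddCommGroup (E x)] [∀ x, Module ℝ (E x)]
  [∀ x, TopologicalSpace (E x)] [TopologicalSpace (TotalSpace F E)]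
  [FiberBundle F E] [VectorBundle ℝ F E] [ContMDiffVectorBundle ∞ F E I]

variable (F E) in
/-- The total space of the dual bundle `E^*`. -/
abbrev DualTotal : Type _ := TotalSpace (F →L[ℝ] ℝ) (fun x : M => E x →L[ℝ] ℝ)

variable (F E) in
/-- The projection `τ : E → M`. -/
abbrev tauE : TotalSpace F E → M := TotalSpace.proj

variable (F E) in
/-- The projection `τ^* : E^* → M`. -/
abbrev tauDual : DualTotal F E → M := TotalSpace.proj

variable (I) in
/-- The vertical lift `b_a^v ∈ T_a E` of `b ∈ E_{τ(a)}` at `a`: the velocity at `t = 0` of the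
curve `t ↦ a + t b` in the fibre. -/
def verticalLift (a : TotalSpace F E) (b : E a.proj) : TangentSpace (I.prod 𝓘(ℝ, F)) a :=
  mfderiv 𝓘(ℝ, ℝ) (I.prod 𝓘(ℝ, F)) (fun t : ℝ => (⟨a.proj, a.snd + t • b⟩ : TotalSpace F E)) 0
    (1 : ℝ)

theorem contMDiff_fibre (e : Trivialization F (TotalSpace.proj : TotalSpace F E → M))
    [MemTrivializationAtlas e] {x : M} (hx : x ∈ e.baseSet) :
    ContMDiff 𝓘(ℝ, F) (I.prod 𝓘(ℝ, F)) ∞ (fun w : F => (⟨x, e.symm x w⟩ : TotalSpace F E)) := by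
  rw [e.contMDiff_iff (fun w => (Trivialization.mem_source _).2 hx)]
  refine ⟨contMDiff_const, ?_⟩
  simp only [e.apply_mk_symm hx]
  exact contMDiff_id

theorem fibre_snd (e : Trivialization F (TotalSpace.proj : TotalSpace F E → M))
    [MemTrivializationAtlas e] (a : TotalSpace F E) (hx : a.proj ∈ e.baseSet) :
    (⟨a.proj, e.symm a.proj (e a).2⟩ : TotalSpace F E) = a := by
  have h1 : (e a).2 = e.continuousLinearMapAt ℝ a.proj a.snd := by
    rw [e.continuousLinearMapAt_apply ℝ, e.coe_linearMapAt_of_mem hx]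
  rw [h1, ← e.symmL_apply (R := ℝ) hx, e.symmL_continuousLinearMapAt hx]

theorem mfderiv_comp_aux {V₁ V₂ V₃ K₁ K₂ K₃ N₁ N₂ N₃ : Type*}
    [NormedAddCommGroup V₁] [NormedSpace ℝ V₁] [TopologicalSpace K₁]
    {J₁ : ModelWithCorners ℝ V₁ K₁} [TopologicalSpace N₁] [ChartedSpace K₁ N₁]
    [NormedAddCommGroup V₂] [NormedSpace ℝ V₂] [TopologicalSpace K₂]
    {J₂ : ModelWithCorners ℝ V₂ K₂} [TopologicalSpace N₂] [ChartedSpace K₂ N₂]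
    [NormedAddCommGroup V₃] [NormedSpace ℝ V₃] [TopologicalSpace K₃]
    {J₃ : ModelWithCorners ℝ V₃ K₃} [TopologicalSpace N₃] [ChartedSpace K₃ N₃]
    {g : N₂ → N₃} {f : N₁ → N₂} {x : N₁} {y : N₂} (hg : MDifferentiableAt J₂ J₃ g y)
    (hf : MDifferentiableAt J₁ J₂ f x) (hy : f x = y) (v : TangentSpace J₁ x) :
    (mfderiv J₁ J₃ (g ∘ f) x v : V₃) = mfderiv J₂ J₃ g y (mfderiv J₁ J₂ f x v : V₂) := by
  subst hy
  exact DFunLike.congr_fun (mfderiv_comp x hg hf) v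

variable (I) in
/-- The vertical lift at `a` read in a trivialization. -/
theorem verticalLift_eq (e : Trivialization F (TotalSpace.proj : TotalSpace F E → M))
    [MemTrivializationAtlas e] (a : TotalSpace F E) (hx : a.proj ∈ e.baseSet) (b : E a.proj) :
    (verticalLift I a b : EM × F) =
      mfderiv 𝓘(ℝ, F) (I.prod 𝓘(ℝ, F)) (fun w : F => (⟨a.proj, e.symm a.proj w⟩ : TotalSpace F E))
        (e a).2 (e.continuousLinearMapAt ℝ a.proj b) := by
  have hc : (fun t : ℝ => (⟨a.proj, a.snd + t • b⟩ : TotalSpace F E)) =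
      (fun w : F => (⟨a.proj, e.symm a.proj w⟩ : TotalSpace F E)) ∘
        (fun t : ℝ => (e a).2 + t • e.continuousLinearMapAt ℝ a.proj b) := by
    funext t
    have h1 : (e a).2 + t • e.continuousLinearMapAt ℝ a.proj b =
        e.continuousLinearMapAt ℝ a.proj (a.snd + t • b) := by
      rw [map_add, map_smul]
      congr 1
      rw [e.continuousLinearMapAt_apply ℝ, e.coe_linearMapAt_of_mem hx]
    simp only [Function.comp_apply, h1]
    rw [← e.symmL_apply (R := ℝ) hx, e.symmL_continuousLinearMapAt hx]
  have hd : HasFDerivAt (fun t : ℝ => (e a).2 + t • e.continuousLinearMapAt ℝ a.proj b)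
      ((1 : ℝ →L[ℝ] ℝ).smulRight (e.continuousLinearMapAt ℝ a.proj b)) 0 :=
    ((hasFDerivAt_id (0 : ℝ)).smul_const _).const_add _
  have hG := (contMDiff_fibre (I := I) e hx).mdifferentiableAt (x := (e a).2) (by simp)
  have h0 : (e a).2 + (0 : ℝ) • e.continuousLinearMapAt ℝ a.proj b = (e a).2 := by simp
  unfold verticalLift
  rw [hc]
  refine (mfderiv_comp_aux (J₂ := 𝓘(ℝ, F)) hG hd.hasMFDerivAt.mdifferentiableAt h0
    (1 : ℝ)).trans ?_
  rw [hd.hasMFDerivAt.mfderiv]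
  congr 1
  exact one_smul ℝ _

theorem mfderiv_proj_verticalLift (a : TotalSpace F E) (b : E a.proj) :
    mfderiv (I.prod 𝓘(ℝ, F)) I (tauE F E) a (verticalLift I a b) = 0 := by
  have hx : a.proj ∈ (trivializationAt F E a.proj).baseSet :=
    FiberBundle.mem_baseSet_trivializationAt' a.proj
  have hp : MDifferentiableAt (I.prod 𝓘(ℝ, F)) I (tauE F E) a :=
    (contMDiff_proj E (n := ∞)).mdifferentiableAt (by simp)
  have hc : MDifferentiableAt 𝓘(ℝ, ℝ) (I.prod 𝓘(ℝ, F))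
      (fun t : ℝ => (⟨a.proj, a.snd + t • b⟩ : TotalSpace F E)) 0 := by
    have h : ContMDiff 𝓘(ℝ, ℝ) (I.prod 𝓘(ℝ, F)) ∞
        (fun t : ℝ => (⟨a.proj, a.snd + t • b⟩ : TotalSpace F E)) := by
      rw [(trivializationAt F E a.proj).contMDiff_iff
        (f := fun t : ℝ => (⟨a.proj, a.snd + t • b⟩ : TotalSpace F E)) (fun w => (Trivialization.mem_source _).2 hx)]
      refine ⟨contMDiff_const, ?_⟩
      have h1 : (fun t : ℝ => ((trivializationAt F E a.proj)
          (⟨a.proj, a.snd + t • b⟩ : TotalSpace F E)).2) = fun t : ℝ =>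
          (trivializationAt F E a.proj).continuousLinearMapAt ℝ a.proj a.snd +
          t • (trivializationAt F E a.proj).continuousLinearMapAt ℝ a.proj b := by
        funext t
        rw [← map_smul, ← map_add, Trivialization.continuousLinearMapAt_apply ℝ,
          Trivialization.coe_linearMapAt_of_mem _ hx]
      rw [h1]
      exact (contDiff_const.add (contDiff_id.smul contDiff_const)).contMDiff
    exact h.mdifferentiableAt (by simp)
  have h := mfderiv_comp_aux hp hc (by simp : _ = a) (1 : ℝ)
  have hconst : tauE F E ∘ (fun t : ℝ => (⟨a.proj, a.snd + t • b⟩ : TotalSpace F E)) =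
      fun _ => a.proj := rfl
  rw [hconst, mfderiv_const] at h
  exact h.symm

variable (A : LieAlgebroid I F E)

/-- The vertical endomorphism `S` of `𝓛^τ E`: `S_a(b, v) = (0, b_a^v)`. -/
def verticalEndo (a : TotalSpace F E) (z : prolongFiber (I.prod 𝓘(ℝ, F)) A (tauE F E) a) :
    prolongFiber (I.prod 𝓘(ℝ, F)) A (tauE F E) a :=
  ⟨(0, verticalLift I a z.1.1), by
    change A.anchor _ 0 = mfderiv (I.prod 𝓘(ℝ, F)) I (tauE F E) a (verticalLift I a z.1.1)
    rw [mfderiv_proj_verticalLift, map_zero]⟩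

/-- The Poincaré–Cartan 1-section `θ_L` of a Lagrangian `L`:
`θ_L(a)(z) = ρ^τ(S_a z)(L)`. -/
def poincareCartan (L : TotalSpace F E → ℝ) :
    Cochain (I.prod 𝓘(ℝ, F)) A (tauE F E) 1 :=
  fun a z => dirDeriv (I.prod 𝓘(ℝ, F)) L a (verticalEndo A a (z 0)).1.2

/-- The Poincaré–Cartan 2-section `ω_L = -d^{𝓛^τ E} θ_L`. -/
def poincareCartanTwo (L : TotalSpace F E → ℝ) :
    Cochain (I.prod 𝓘(ℝ, F)) A (tauE F E) 2 :=
  -differential (poincareCartan A L)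

/-- The Liouville section `λ_E`: `λ_E(a^*)(b, v) = a^*(b)`. -/
def liouville : Cochain (I.prod 𝓘(ℝ, F →L[ℝ] ℝ)) A (tauDual F E) 1 :=
  fun p z => p.snd (z 0).1.1

/-- The canonical symplectic section `Ω_E = -d^{𝓛^{τ^*} E} λ_E`. -/
def canonicalSymplectic : Cochain (I.prod 𝓘(ℝ, F →L[ℝ] ℝ)) A (tauDual F E) 2 :=
  -differential (liouville A)

variable (I) in
theorem exists_fibreDeriv (L : TotalSpace F E → ℝ) (a : TotalSpace F E) :
    ∃ ℓ : E a.proj →L[ℝ] ℝ, ∀ b, ℓ b = dirDeriv (I.prod 𝓘(ℝ, F)) L a (verticalLift I a b) := by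
  have hx : a.proj ∈ (trivializationAt F E a.proj).baseSet :=
    FiberBundle.mem_baseSet_trivializationAt' a.proj
  let ℓ₁ : EM × F →L[ℝ] ℝ := mfderiv (I.prod 𝓘(ℝ, F)) 𝓘(ℝ, ℝ) L a
  let ℓ₂ : F →L[ℝ] EM × F := mfderiv 𝓘(ℝ, F) (I.prod 𝓘(ℝ, F))
    (fun w : F => (⟨a.proj, (trivializationAt F E a.proj).symm a.proj w⟩ : TotalSpace F E))
    (trivializationAt F E a.proj a).2
  refine ⟨ℓ₁.comp (ℓ₂.comp ((trivializationAt F E a.proj).continuousLinearMapAt ℝ a.proj)),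
    fun b => ?_⟩
  exact (congrArg ℓ₁ (verticalLift_eq I (trivializationAt F E a.proj) a hx b)).symm

variable (I) in
/-- The Legendre transformation `Leg_L : E → E^*`, with `Leg_L(a)(b) = b_a^v(L)`. By
`legendre_eq` below, `Leg_L(a)(b) = θ_L(a)(z)` for every `z ∈ (𝓛^τ E)_a` with first component
`b`. -/
def legendre (L : TotalSpace F E → ℝ) (a : TotalSpace F E) : DualTotal F E :=
  ⟨a.proj,
    { toFun := fun b => dirDeriv (I.prod 𝓘(ℝ, F)) L a (verticalLift I a b)
      map_add' := fun b c => by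
        obtain ⟨ℓ, h⟩ := exists_fibreDeriv I L a
        simp only [← h, map_add]
      map_smul' := fun r b => by
        obtain ⟨ℓ, h⟩ := exists_fibreDeriv I L a
        simp only [← h, map_smul, RingHom.id_apply]
      cont := by
        obtain ⟨ℓ, h⟩ := exists_fibreDeriv I L a
        simp only [← h]
        exact ℓ.continuous }⟩

theorem legendre_eq (L : TotalSpace F E → ℝ) (a : TotalSpace F E)
    (z : prolongFiber (I.prod 𝓘(ℝ, F)) A (tauE F E) a) :
    (legendre I L a).snd z.1.1 = poincareCartan A L a (fun _ => z) := rfl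

theorem contMDiff_legendre {L : TotalSpace F E → ℝ}
    (hL : ContMDiff (I.prod 𝓘(ℝ, F)) 𝓘(ℝ, ℝ) ∞ L) :
    ContMDiff (I.prod 𝓘(ℝ, F)) (I.prod 𝓘(ℝ, F →L[ℝ] ℝ)) ∞ (legendre I L) := by
  intro a₀
  refine (contMDiffAt_hom_bundle (E₂ := fun _ : M => ℝ) (legendre I L)).2
    ⟨contMDiffAt_proj E, ?_⟩
  set e := trivializationAt F E a₀.proj with he
  have hx₀ : a₀.proj ∈ e.baseSet := FiberBundle.mem_baseSet_trivializationAt' a₀.proj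
  have hsource : a₀ ∈ e.source := (Trivialization.mem_source _).2 hx₀
  let G : TotalSpace F E → F → ℝ := fun a w => L ⟨a.proj, e.symm a.proj w⟩
  have hg : ContMDiffAt (I.prod 𝓘(ℝ, F)) 𝓘(ℝ, F) ∞ (fun a => (e a).2) a₀ :=
    ((e.contMDiffAt_iff hsource).1 contMDiffAt_id).2
  have hG : ContMDiffAt ((I.prod 𝓘(ℝ, F)).prod 𝓘(ℝ, F)) 𝓘(ℝ, ℝ) ∞ (Function.uncurry G)
      (a₀, (e a₀).2) := by
    have h1 : ContMDiffAt ((I.prod 𝓘(ℝ, F)).prod 𝓘(ℝ, F)) (I.prod 𝓘(ℝ, F)) ∞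
        (fun p : TotalSpace F E × F => (⟨p.1.proj, e.symm p.1.proj p.2⟩ : TotalSpace F E))
        (a₀, (e a₀).2) := by
      rw [e.contMDiffAt_iff ((Trivialization.mem_source _).2 hx₀)]
      refine ⟨((contMDiff_proj E).comp contMDiff_fst).contMDiffAt, ?_⟩
      refine (contMDiffAt_snd (M := TotalSpace F E) (N := F)).congr_of_eventuallyEq ?_
      have hU : IsOpen {p : TotalSpace F E × F | p.1.proj ∈ e.baseSet} :=
        e.open_baseSet.preimage ((FiberBundle.continuous_proj F E).comp continuous_fst)
      filter_upwards [hU.mem_nhds hx₀] with p hp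
      rw [e.apply_mk_symm hp]
    exact (hL _).comp _ h1
  have key := ContMDiffAt.mfderiv (I := 𝓘(ℝ, F)) (I' := 𝓘(ℝ, ℝ)) G (fun a => (e a).2) hG hg
    (m := ∞) (by simp)
  let D : TotalSpace F E → F →L[ℝ] ℝ := fun a => mfderiv 𝓘(ℝ, F) 𝓘(ℝ, ℝ) (G a) (e a).2
  have key' : ContMDiffAt (I.prod 𝓘(ℝ, F)) 𝓘(ℝ, F →L[ℝ] ℝ) ∞
      D a₀ := by
    have hk := inTangentCoordinates_model_space (I := 𝓘(ℝ, F)) (I' := 𝓘(ℝ, ℝ))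
      (fun a => (e a).2) (fun a => G a (e a).2) D a₀
    rw [← hk]
    exact key
  refine key'.congr_of_eventuallyEq ?_
  have hU : IsOpen {a : TotalSpace F E | a.proj ∈ e.baseSet} :=
    e.open_baseSet.preimage (FiberBundle.continuous_proj F E)
  filter_upwards [hU.mem_nhds hx₀] with a ha
  ext w
  have h1 := mfderiv_comp_aux (J₁ := 𝓘(ℝ, F)) (J₃ := 𝓘(ℝ, ℝ)) (x := (e a).2) (y := a)
    (hL.mdifferentiableAt (by simp)) ((contMDiff_fibre (I := I) e ha).mdifferentiableAt (by simp))
    (fibre_snd e a ha) w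
  refine Eq.trans ?_ h1.symm
  have h2 := verticalLift_eq I e a ha (e.symmL ℝ a.proj w)
  rw [e.continuousLinearMapAt_symmL ha] at h2
  refine Eq.trans ?_ (congrArg (fun v : EM × F =>
    (mfderiv (I.prod 𝓘(ℝ, F)) 𝓘(ℝ, ℝ) L a : EM × F →L[ℝ] ℝ) v) h2)
  simp [ContinuousLinearMap.inCoordinates, legendre, dirDeriv, ← he]
  rfl

/-- The map `𝓛Leg_L : 𝓛^τ E → 𝓛^{τ^*} E` over `Leg_L`:
`𝓛Leg_L(b, X_a) = (b, (T_a Leg_L)(X_a))`. -/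
def prolongLegendre {L : TotalSpace F E → ℝ}
    (hL : ContMDiff (I.prod 𝓘(ℝ, F)) 𝓘(ℝ, ℝ) ∞ L) (a : TotalSpace F E) :
    prolongFiber (I.prod 𝓘(ℝ, F)) A (tauE F E) a →ₗ[ℝ]
      prolongFiber (I.prod 𝓘(ℝ, F →L[ℝ] ℝ)) A (tauDual F E) (legendre I L a) where
  toFun z := ⟨(z.1.1, mfderiv (I.prod 𝓘(ℝ, F)) (I.prod 𝓘(ℝ, F →L[ℝ] ℝ)) (legendre I L) a z.1.2),
    by
      have hp : MDifferentiableAt (I.prod 𝓘(ℝ, F →L[ℝ] ℝ)) I (tauDual F E) (legendre I L a) :=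
        (contMDiff_proj _ (n := ∞)).mdifferentiableAt (by simp)
      have hl : MDifferentiableAt (I.prod 𝓘(ℝ, F)) (I.prod 𝓘(ℝ, F →L[ℝ] ℝ)) (legendre I L) a :=
        (contMDiff_legendre hL).mdifferentiableAt (by simp)
      have h := mfderiv_comp a hp hl
      have hz : A.anchor a.proj z.1.1 = mfderiv (I.prod 𝓘(ℝ, F)) I (tauE F E) a z.1.2 := z.2
      exact hz.trans (DFunLike.congr_fun h z.1.2)⟩
  map_add' z w := Subtype.ext (Prod.ext rfl (map_add
    (mfderiv (I.prod 𝓘(ℝ, F)) (I.prod 𝓘(ℝ, F →L[ℝ] ℝ)) (legendre I L) a) z.1.2 w.1.2))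
  map_smul' r z := Subtype.ext (Prod.ext rfl (map_smul
    (mfderiv (I.prod 𝓘(ℝ, F)) (I.prod 𝓘(ℝ, F →L[ℝ] ℝ)) (legendre I L) a) r z.1.2))

end Lagrangian

end LieAlgd

end

/-!
A smooth map `φ : N → E'` into the total space of a vector bundle `E'` over `M` induces the map
`Φ(b, v) = (b, Tφ(v))` from the prolongation of `E` over `π ∘ φ` to the prolongation of `E` over the
projection `π : E' → M`, and the pull-back along `(Φ, φ)` commutes with the differentials
(`differential_pullback_prolongMap`). The map `𝓛Leg_L` is the case `φ = Leg_L`, and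
`Leg_L^* λ_E = θ_L` holds by definition of `Leg_L`; the statement on `Ω_E` follows by taking
differentials.

The reason is a computation in coordinates near a point `a₀` of `E'`. A trivialization of `E` and
one of `E'` give coordinates `c_a : (𝓛^π E)_a → F × F'` on the fibres (`prolongCoord`): the
coordinates of `b`, and the derivative along `v` of the fibre coordinate of `E'`. They are injective
because the anchor condition determines the projection of `v` to `TM`. For sections `X`, `Y` over
`N`, with coordinates `G_X = c ∘ Φ ∘ X` and `G_Y` depending on the point of `N`, the bracket has
coordinates `G_{⟦X, Y⟧} = (β(G_X, G_Y), 0) + X'(G_Y) - Y'(G_X)`, where `X'`, `Y'` are the vector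
fields on `N` and `β` is the bracket of sections of `E` with constant coordinates
(`pushCoord_prolongBracket`). A form on `𝓛^π E` becomes a family `m` of alternating maps on `F ×
F'`, and in the alternating sum `koszul` the derivatives of the `G`'s cancel
(`sum_mvfderiv_alternating`). What remains, `koszulCoord`, involves only `m` near `a₀`, its
derivatives along the vectors `Tφ(X'ᵢ)`, and the values `Φ(Xᵢ)` at one point. So the same number
results from the form and sections over `E'` (`koszul_pullback`). For `φ = id` this says that the
differential is well defined (`differential_eval`), and together with the fact that every element
of a fibre is the value of a section (`exists_eval_eq`) it gives the theorem.

That the bracket of sections of a prolongation exists and satisfies its defining formula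
(`isProlongBracket_prolongBracket`) rests on two facts: the bracket of sections of `E` is local,
with `β` in coordinates (`LieAlgebroid.fibreCoord_bracket`), and the anchor of `E` is compatible
with the brackets (`LieAlgebroid.mvfderiv_anchor_bracket`).
-/

noncomputable section

namespace LieAlgd

/-! ### Vector-valued functions and the Lie bracket of vector fields -/

section VectorFields

variable {EN : Type*} [NormedAddCommGroup EN] [NormedSpace ℝ EN]
  {HN : Type*} [TopologicalSpace HN] {J : ModelWithCorners ℝ EN HN}
  {N : Type*} [TopologicalSpace N] [ChartedSpace HN N]
  {V : Type*} [NormedAddCommGroup V] [NormedSpace ℝ V]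
  {W : Type*} [NormedAddCommGroup W] [NormedSpace ℝ W]

theorem mvfderiv_congr {u u' : N → V} {x : N} (h : u =ᶠ[𝓝 x] u') (v : TangentSpace J x) :
    mvfderiv J u x v = mvfderiv J u' x v := by
  have h1 : (mfderiv J 𝓘(ℝ, V) u x : TangentSpace J x →L[ℝ] V) = mfderiv J 𝓘(ℝ, V) u' x :=
    Filter.EventuallyEq.mfderiv_eq h
  exact DFunLike.congr_fun h1 v

/-- The chain rule for a map into a vector space, differentiated along a vector. -/
theorem mvfderiv_comp_of_eq_apply {EN' : Type*} [NormedAddCommGroup EN'] [NormedSpace ℝ EN']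
    {HN' : Type*} [TopologicalSpace HN'] {J' : ModelWithCorners ℝ EN' HN'}
    {N' : Type*} [TopologicalSpace N'] [ChartedSpace HN' N']
    {u : N' → V} {g : N → N'} {x : N} {y : N'} (hu : MDifferentiableAt J' 𝓘(ℝ, V) u y)
    (hg : MDifferentiableAt J J' g x) (hy : g x = y) (v : TangentSpace J x) :
    mvfderiv J (fun z => u (g z)) x v = mvfderiv J' u y (mfderiv J J' g x v : EN') := by
  subst hy
  exact DFunLike.congr_fun (mfderiv_comp x hu hg) v

theorem mvfderiv_eq_fderiv (f : V → W) (x v : V) :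
    mvfderiv 𝓘(ℝ, V) f x v = fderiv ℝ f x v :=
  DFunLike.congr_fun (mfderiv_eq_fderiv (𝕜 := ℝ) (f := f) (x := x)) v

theorem mvfderiv_clm_comp (ℓ : V →L[ℝ] W) {u : N → V} {x : N}
    (hu : MDifferentiableAt J 𝓘(ℝ, V) u x) (v : TangentSpace J x) :
    mvfderiv J (fun y => ℓ (u y)) x v = ℓ (mvfderiv J u x v) := by
  have h := mvfderiv_comp_of_eq_apply (J' := 𝓘(ℝ, V)) (u := ℓ)
    ℓ.differentiableAt.mdifferentiableAt hu rfl v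
  refine h.trans ((mvfderiv_eq_fderiv ℓ (u x) _).trans ?_)
  rw [ℓ.fderiv]
  rfl

theorem mvfderiv_sum {ι : Type*} (s : Finset ι) {u : ι → N → V} {x : N}
    (hu : ∀ i ∈ s, MDifferentiableAt J 𝓘(ℝ, V) (u i) x) (v : TangentSpace J x) :
    mvfderiv J (fun y => ∑ i ∈ s, u i y) x v = ∑ i ∈ s, mvfderiv J (u i) x v := by
  classical
  have key : MDifferentiableAt J 𝓘(ℝ, V) (fun y => ∑ i ∈ s, u i y) x ∧
      mvfderiv J (fun y => ∑ i ∈ s, u i y) x v = ∑ i ∈ s, mvfderiv J (u i) x v := by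
    induction s using Finset.induction_on with
    | empty =>
      simp only [Finset.sum_empty]
      exact ⟨mdifferentiableAt_const, by rw [mvfderiv_const]; rfl⟩
    | insert i s hi ih =>
      obtain ⟨h1, h2⟩ := ih (fun j hj => hu j (Finset.mem_insert_of_mem hj))
      have h0 := hu i (Finset.mem_insert_self i s)
      simp only [Finset.sum_insert hi]
      refine ⟨h0.add h1, ?_⟩
      rw [← h2]
      exact DFunLike.congr_fun (mvfderiv_add h0 h1) v
  exact key.2

variable [IsManifold J ∞ N] [J.Boundaryless]

/-- In the chart at `x`, the derivative of `u` along a vector field `X` is the derivative of the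
local representative of `u` along the local representative of `X`. -/
theorem fderiv_comp_extChartAt_symm {u : N → V} {x : N} {z : EN}
    (hz : z ∈ (extChartAt J x).target)
    (hu : MDifferentiableAt J 𝓘(ℝ, V) u ((extChartAt J x).symm z))
    (X : ∀ y, TangentSpace J y) :
    fderiv ℝ (u ∘ (extChartAt J x).symm) z
        (VectorField.mpullbackWithin 𝓘(ℝ, EN) J (extChartAt J x).symm X (Set.range J) z : EN) =
      mvfderiv J u ((extChartAt J x).symm z) (X ((extChartAt J x).symm z)) := by
  have hs : MDifferentiableAt 𝓘(ℝ, EN) J (extChartAt J x).symm z := by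
    have := mdifferentiableWithinAt_extChartAt_symm (I := J) hz
    rwa [J.range_eq_univ, mdifferentiableWithinAt_univ] at this
  have h1 := mvfderiv_comp_of_eq_apply hu hs rfl
    (VectorField.mpullbackWithin 𝓘(ℝ, EN) J (extChartAt J x).symm X (Set.range J) z)
  have h2 : (mfderiv 𝓘(ℝ, EN) J (extChartAt J x).symm z)
      (VectorField.mpullbackWithin 𝓘(ℝ, EN) J (extChartAt J x).symm X (Set.range J) z) =
      X ((extChartAt J x).symm z) := by
    have h3 := isInvertible_mfderivWithin_extChartAt_symm (I := J) hz
    rw [VectorField.mpullbackWithin_apply]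
    rw [J.range_eq_univ, mfderivWithin_univ] at h3 ⊢
    exact h3.self_apply_inverse _
  rw [h2] at h1
  exact (mvfderiv_eq_fderiv (u ∘ (extChartAt J x).symm) z _).symm.trans h1

/-- The Lie bracket of vector fields acts on vector-valued functions as the commutator of the
derivations: `[X, Y](u) = X(Y(u)) - Y(X(u))`. -/
theorem mvfderiv_mlieBracket [CompleteSpace EN] {X Y : ∀ y, TangentSpace J y} {u : N → V} {x : N}
    (hX : ContMDiffAt J J.tangent ∞ (fun y => (⟨y, X y⟩ : TangentBundle J N)) x)
    (hY : ContMDiffAt J J.tangent ∞ (fun y => (⟨y, Y y⟩ : TangentBundle J N)) x)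
    (hu : ContMDiffAt J 𝓘(ℝ, V) ∞ u x) :
    mvfderiv J u x (VectorField.mlieBracket J X Y x) =
      mvfderiv J (fun y => mvfderiv J u y (Y y)) x (X x) -
      mvfderiv J (fun y => mvfderiv J u y (X y)) x (Y x) := by
  set φ := extChartAt J x with hφ
  have h2 : (2 : ℕ∞ω) ≤ ∞ := WithTop.coe_le_coe.2 (le_top : (2 : ℕ∞) ≤ ⊤)
  have : IsManifold J 2 N := IsManifold.of_le h2
  have hφx : φ.symm (φ x) = x := extChartAt_to_inv x
  have hmem : φ x ∈ φ.target := mem_extChartAt_target x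
  have hopen : IsOpen φ.target := isOpen_extChartAt_target x
  have hsymm : ContMDiffAt 𝓘(ℝ, EN) J ∞ φ.symm (φ x) :=
    (contMDiffOn_extChartAt_symm x).contMDiffAt (hopen.mem_nhds hmem)
  have huhat : ContDiffAt ℝ ∞ (u ∘ φ.symm) (φ x) :=
    ContMDiffAt.contDiffAt (ContMDiffAt.comp (φ x) (by rwa [hφx]) hsymm)
  -- the representative of a vector field in the chart
  let hat (Z : ∀ y, TangentSpace J y) : EN → EN :=
    VectorField.mpullbackWithin 𝓘(ℝ, EN) J φ.symm Z (Set.range J)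
  have hhat (Z : ∀ y, TangentSpace J y)
      (hZ : ContMDiffAt J J.tangent ∞ (fun y => (⟨y, Z y⟩ : TangentBundle J N)) x) :
      DifferentiableAt ℝ (hat Z) (φ x) := by
    have h := MDifferentiableWithinAt.differentiableWithinAt_mpullbackWithin_vectorField
      (s := Set.univ) (hZ.mdifferentiableAt (by simp)).mdifferentiableWithinAt
    rw [Set.preimage_univ, Set.univ_inter, ← hφ] at h
    refine h.differentiableAt ?_
    rw [J.range_eq_univ]
    exact Filter.univ_mem
  have hhat_apply (Z : ∀ y, TangentSpace J y) : hat Z (φ x) = Z x := by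
    change (mfderivWithin 𝓘(ℝ, EN) J φ.symm (Set.range J) (φ x)).inverse (Z (φ.symm (φ x))) = Z x
    have h := mfderivWithin_extChartAt_symm_inverse_apply (I := J) (x := x)
    rw [← hφ] at h
    refine (h _).trans ?_
    rw [hφx]
  have humd : ∀ᶠ y in 𝓝 x, MDifferentiableAt J 𝓘(ℝ, V) u y := by
    have h1 : ContMDiffAt J 𝓘(ℝ, V) 1 u x := hu.of_le (by simp)
    filter_upwards [(contMDiffAt_iff_contMDiffAt_nhds (by simp)).1 h1] with y hy
    exact hy.mdifferentiableAt (by simp)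
  have hloc (Z : ∀ y, TangentSpace J y) :
      (fun y => mvfderiv J u y (Z y)) ∘ φ.symm =ᶠ[𝓝 (φ x)]
        fun z => fderiv ℝ (u ∘ φ.symm) z (hat Z z) := by
    have hc : ContinuousAt φ.symm (φ x) := hsymm.continuousAt
    have h1 : ∀ᶠ z in 𝓝 (φ x), MDifferentiableAt J 𝓘(ℝ, V) u (φ.symm z) :=
      hc.eventually (by rwa [hφx])
    filter_upwards [h1, hopen.mem_nhds hmem] with z hz hz'
    exact (fderiv_comp_extChartAt_symm hz' hz Z).symm
  have hchart (g : N → V) (hg : DifferentiableAt ℝ (g ∘ φ.symm) (φ x)) (v : TangentSpace J x) :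
      mvfderiv J g x v = fderiv ℝ (g ∘ φ.symm) (φ x) v := by
    have h1 : g =ᶠ[𝓝 x] fun y => (g ∘ φ.symm) (φ y) := by
      filter_upwards [extChartAt_source_mem_nhds (I := J) x] with y hy
      simp only [Function.comp_apply]
      rw [φ.left_inv hy]
    rw [mvfderiv_congr h1, mvfderiv_comp_of_eq_apply (J' := 𝓘(ℝ, EN)) hg.mdifferentiableAt
      (mdifferentiableAt_extChartAt (mem_chart_source HN x)) rfl, mfderiv_extChartAt_self]
    exact mvfderiv_eq_fderiv (g ∘ φ.symm) (φ x) v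
  have hD2 : DifferentiableAt ℝ (fderiv ℝ (u ∘ φ.symm)) (φ x) :=
    (huhat.fderiv_right (m := 1) h2).differentiableAt (by simp)
  -- second derivatives of `u` enter `X(Y(u))` and `Y(X(u))` symmetrically and cancel
  have hder (Z Z' : ∀ y, TangentSpace J y)
      (hZ : ContMDiffAt J J.tangent ∞ (fun y => (⟨y, Z y⟩ : TangentBundle J N)) x) :
      mvfderiv J (fun y => mvfderiv J u y (Z y)) x (Z' x) =
        fderiv ℝ (fderiv ℝ (u ∘ φ.symm)) (φ x) (hat Z' (φ x)) (hat Z (φ x)) +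
        fderiv ℝ (u ∘ φ.symm) (φ x) (fderiv ℝ (hat Z) (φ x) (hat Z' (φ x))) := by
    have h1 : DifferentiableAt ℝ (fun z => fderiv ℝ (u ∘ φ.symm) z (hat Z z)) (φ x) :=
      hD2.clm_apply (hhat Z hZ)
    rw [hchart _ (h1.congr_of_eventuallyEq (hloc Z)), (hloc Z).fderiv_eq,
      fderiv_clm_apply hD2 (hhat Z hZ), ← hhat_apply Z']
    simp [add_comm]
  have hbr : VectorField.mlieBracket J X Y x = VectorField.lieBracket ℝ (hat X) (hat Y) (φ x) := by
    rw [← VectorField.mlieBracketWithin_univ, VectorField.mlieBracketWithin_apply]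
    rw [mfderiv_extChartAt_self, Set.preimage_univ, Set.univ_inter]
    have hid : (ContinuousLinearMap.id ℝ EN).inverse = ContinuousLinearMap.id ℝ EN :=
      ContinuousLinearMap.inverse_id
    refine (DFunLike.congr_fun hid
      (VectorField.lieBracketWithin ℝ (hat X) (hat Y) (Set.range J) (φ x))).trans ?_
    rw [J.range_eq_univ, VectorField.lieBracketWithin_univ]
    rfl
  have hsy := huhat.isSymmSndFDerivAt (by simpa using h2) (hat X (φ x)) (hat Y (φ x))
  have hlie : mvfderiv J u x (VectorField.mlieBracket J X Y x) =
      fderiv ℝ (u ∘ φ.symm) (φ x) (VectorField.lieBracket ℝ (hat X) (hat Y) (φ x)) :=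
    (congrArg _ hbr).trans (hchart u (huhat.differentiableAt (by simp)) _)
  rw [hder Y X hY, hder X Y hX, hlie, VectorField.lieBracket, hsy, map_sub]
  abel

end VectorFields

/-! ### Smooth sections along a map -/

section Along

variable {EM : Type*} [NormedAddCommGroup EM] [NormedSpace ℝ EM]
  {H : Type*} [TopologicalSpace H] {I : ModelWithCorners ℝ EM H}
  {M : Type*} [TopologicalSpace M] [ChartedSpace H M]
  {F : Type*} [NormedAddCommGroup F] [NormedSpace ℝ F]
  {E : M → Type*} [∀ x, AddCommGroup (E x)] [∀ x, Module ℝ (E x)]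
  [∀ x, TopologicalSpace (E x)] [TopologicalSpace (TotalSpace F E)]
  [FiberBundle F E] [VectorBundle ℝ F E]

variable (F E) in
/-- The coordinate map `E_x → F` of the preferred trivialization at `x₀`; it is linear in the
fibre, and the zero map when `x` lies outside the base set of the trivialization. -/
def fibreCoord (x₀ x : M) : E x →L[ℝ] F :=
  (trivializationAt F E x₀).continuousLinearMapAt ℝ x

theorem fibreCoord_apply {x₀ x : M} (hx : x ∈ (trivializationAt F E x₀).baseSet) (b : E x) :
    fibreCoord F E x₀ x b = (trivializationAt F E x₀ ⟨x, b⟩).2 :=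
  Trivialization.continuousLinearMapAt_apply_of_mem (R := ℝ) _ hx b

theorem fibreCoord_injective {x₀ x : M} (hx : x ∈ (trivializationAt F E x₀).baseSet) :
    Function.Injective (fibreCoord F E x₀ x) :=
  Function.LeftInverse.injective
    (g := (trivializationAt F E x₀).symmL ℝ x) (Trivialization.symmL_continuousLinearMapAt _ hx)

variable (F E) in
theorem eventually_mem_baseSet (x₀ : M) :
    ∀ᶠ x in 𝓝 x₀, x ∈ (trivializationAt F E x₀).baseSet :=
  (trivializationAt F E x₀).open_baseSet.mem_nhds (FiberBundle.mem_baseSet_trivializationAt' x₀)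

variable [ContMDiffVectorBundle ∞ F E I]
  {EN : Type*} [NormedAddCommGroup EN] [NormedSpace ℝ EN]
  {HN : Type*} [TopologicalSpace HN] {J : ModelWithCorners ℝ EN HN}
  {N : Type*} [TopologicalSpace N] [ChartedSpace HN N]

/-- Smoothness of a section along a map, in terms of its coordinates. -/
theorem contMDiffAt_along_iff {f : N → M} {σ : ∀ y, E (f y)} {y₀ : N} {x₀ : M}
    (hx : f y₀ ∈ (trivializationAt F E x₀).baseSet) :
    ContMDiffAt J (I.prod 𝓘(ℝ, F)) ∞ (fun y => (⟨f y, σ y⟩ : TotalSpace F E)) y₀ ↔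
      ContMDiffAt J I ∞ f y₀ ∧
        ContMDiffAt J 𝓘(ℝ, F) ∞ (fun y => fibreCoord F E x₀ (f y) (σ y)) y₀ := by
  rw [(trivializationAt F E x₀).contMDiffAt_iff (f := fun y => (⟨f y, σ y⟩ : TotalSpace F E))
    ((Trivialization.mem_source _).2 hx)]
  refine and_congr_right fun hf => ?_
  have h : (fun y => (trivializationAt F E x₀ ⟨f y, σ y⟩).2) =ᶠ[𝓝 y₀]
      fun y => fibreCoord F E x₀ (f y) (σ y) := by
    filter_upwards [hf.continuousAt.preimage_mem_nhds
      ((trivializationAt F E x₀).open_baseSet.mem_nhds hx)] with y hy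
    exact (fibreCoord_apply hy _).symm
  exact h.contMDiffAt_iff

theorem contMDiffAt_along_zero {f : N → M} {y₀ : N} (hf : ContMDiffAt J I ∞ f y₀) :
    ContMDiffAt J (I.prod 𝓘(ℝ, F)) ∞ (fun y => (⟨f y, 0⟩ : TotalSpace F E)) y₀ := by
  rw [contMDiffAt_along_iff (FiberBundle.mem_baseSet_trivializationAt' (f y₀))]
  refine ⟨hf, ?_⟩
  simp only [map_zero]
  exact contMDiffAt_const

theorem contMDiffAt_along_add {f : N → M} {σ σ' : ∀ y, E (f y)} {y₀ : N}
    (h : ContMDiffAt J (I.prod 𝓘(ℝ, F)) ∞ (fun y => (⟨f y, σ y⟩ : TotalSpace F E)) y₀)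
    (h' : ContMDiffAt J (I.prod 𝓘(ℝ, F)) ∞ (fun y => (⟨f y, σ' y⟩ : TotalSpace F E)) y₀) :
    ContMDiffAt J (I.prod 𝓘(ℝ, F)) ∞ (fun y => (⟨f y, σ y + σ' y⟩ : TotalSpace F E)) y₀ := by
  rw [contMDiffAt_along_iff (FiberBundle.mem_baseSet_trivializationAt' (f y₀))] at *
  simp only [map_add]
  exact ⟨h.1, h.2.add h'.2⟩

theorem contMDiffAt_along_smul {f : N → M} {c : N → ℝ} {σ : ∀ y, E (f y)} {y₀ : N}
    (hc : ContMDiffAt J 𝓘(ℝ, ℝ) ∞ c y₀)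
    (h : ContMDiffAt J (I.prod 𝓘(ℝ, F)) ∞ (fun y => (⟨f y, σ y⟩ : TotalSpace F E)) y₀) :
    ContMDiffAt J (I.prod 𝓘(ℝ, F)) ∞ (fun y => (⟨f y, c y • σ y⟩ : TotalSpace F E)) y₀ := by
  rw [contMDiffAt_along_iff (FiberBundle.mem_baseSet_trivializationAt' (f y₀))] at *
  simp only [map_smul]
  exact ⟨h.1, hc.smul h.2⟩

theorem contMDiffAt_along_sum {f : N → M} {ι : Type*} (s : Finset ι) {σ : ι → ∀ y, E (f y)}
    {y₀ : N} (hf : ContMDiffAt J I ∞ f y₀)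
    (h : ∀ i ∈ s,
      ContMDiffAt J (I.prod 𝓘(ℝ, F)) ∞ (fun y => (⟨f y, σ i y⟩ : TotalSpace F E)) y₀) :
    ContMDiffAt J (I.prod 𝓘(ℝ, F)) ∞
      (fun y => (⟨f y, ∑ i ∈ s, σ i y⟩ : TotalSpace F E)) y₀ := by
  rw [contMDiffAt_along_iff (FiberBundle.mem_baseSet_trivializationAt' (f y₀))]
  simp only [map_sum]
  refine ⟨hf, contMDiffAt_finsetSum fun i hi => ?_⟩
  exact ((contMDiffAt_along_iff (FiberBundle.mem_baseSet_trivializationAt' (f y₀))).1 (h i hi)).2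

/-- A section along a map that is smooth on the support of a smooth function becomes smooth
everywhere after multiplication by this function. -/
theorem contMDiff_along_cutoff {f : N → M} (hf : ContMDiff J I ∞ f) {c : N → ℝ}
    (hc : ContMDiff J 𝓘(ℝ, ℝ) ∞ c) {σ : ∀ y, E (f y)}
    (h : ∀ y ∈ tsupport c,
      ContMDiffAt J (I.prod 𝓘(ℝ, F)) ∞ (fun y => (⟨f y, σ y⟩ : TotalSpace F E)) y) :
    ContMDiff J (I.prod 𝓘(ℝ, F)) ∞ (fun y => (⟨f y, c y • σ y⟩ : TotalSpace F E)) := by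
  intro y
  by_cases hy : y ∈ tsupport c
  · exact contMDiffAt_along_smul (hc y) (h y hy)
  · refine (contMDiffAt_along_zero (F := F) (E := E) (hf y)).congr_of_eventuallyEq ?_
    filter_upwards [(isClosed_tsupport c).isOpen_compl.mem_nhds hy] with z hz
    rw [image_eq_zero_of_notMem_tsupport hz, zero_smul]

theorem contMDiffAt_section_comp (X : Cₛ^∞⟮I; F, E⟯) {f : N → M} {y₀ : N}
    (hf : ContMDiffAt J I ∞ f y₀) :
    ContMDiffAt J (I.prod 𝓘(ℝ, F)) ∞ (fun y => (⟨f y, X (f y)⟩ : TotalSpace F E)) y₀ :=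
  ContMDiffAt.comp y₀ (X.contMDiff (f y₀)) hf

end Along

/-! ### Derivatives along vector fields -/

section VectorFieldDerivative

variable {EN : Type*} [NormedAddCommGroup EN] [NormedSpace ℝ EN]
  {HN : Type*} [TopologicalSpace HN] {J : ModelWithCorners ℝ EN HN}
  {N : Type*} [TopologicalSpace N] [ChartedSpace HN N] [IsManifold J ∞ N]
  {V : Type*} [NormedAddCommGroup V] [NormedSpace ℝ V]

/-- The derivative of a smooth function along a smooth vector field is smooth. -/
theorem contMDiffAt_mvfderiv_apply {u : N → V} {X : ∀ x, TangentSpace J x} {x : N}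
    (hu : ContMDiffAt J 𝓘(ℝ, V) ∞ u x)
    (hX : ContMDiffAt J J.tangent ∞ (fun y => (⟨y, X y⟩ : TangentBundle J N)) x) :
    ContMDiffAt J 𝓘(ℝ, V) ∞ (fun y => mvfderiv J u y (X y)) x := by
  have h1 := hu.mfderiv_const (m := ∞) (by simp)
  have h2 := ContMDiffAt.clm_apply_of_inCoordinates (n := ∞) h1 hX hu
  have h3 := (contMDiff_snd_tangentBundle_modelSpace V 𝓘(ℝ, V) (n := ∞)).contMDiffAt.comp x h2
  exact h3

end VectorFieldDerivative

/-! ### Extension of functions by bump functions -/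

section Bump

variable {EM : Type*} [NormedAddCommGroup EM] [NormedSpace ℝ EM] [FiniteDimensional ℝ EM]
  {H : Type*} [TopologicalSpace H] {I : ModelWithCorners ℝ EM H}
  {M : Type*} [TopologicalSpace M] [ChartedSpace H M] [IsManifold I ∞ M] [T2Space M]
  {V : Type*} [NormedAddCommGroup V] [NormedSpace ℝ V]

variable (I) in
theorem exists_bump {x₀ : M} {U : Set M} (hU : U ∈ 𝓝 x₀) :
    ∃ χ : C^∞⟮I, M; 𝓘(ℝ, ℝ), ℝ⟯, (∀ᶠ x in 𝓝 x₀, χ x = 1) ∧ tsupport χ ⊆ U := by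
  obtain ⟨χ, -, hχ⟩ := (SmoothBumpFunction.nhds_basis_tsupport (I := I) x₀).mem_iff.1 hU
  exact ⟨⟨χ, χ.contMDiff⟩, χ.eventuallyEq_one, hχ⟩

/-- A function that is smooth on a neighbourhood of `x₀` agrees near `x₀` with a smooth function on
the whole manifold. -/
theorem exists_contMDiffMap_eventuallyEq {x₀ : M} {U : Set M} (hU : U ∈ 𝓝 x₀) {g : M → V}
    (hg : ∀ x ∈ U, ContMDiffAt I 𝓘(ℝ, V) ∞ g x) :
    ∃ u : C^∞⟮I, M; 𝓘(ℝ, V), V⟯, ∀ᶠ x in 𝓝 x₀, u x = g x := by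
  obtain ⟨χ, h1, h2⟩ := exists_bump I hU
  refine ⟨⟨fun x => χ x • g x, contMDiff_of_tsupport fun x hx => ?_⟩, ?_⟩
  · exact (χ.contMDiff x).smul (hg x (h2 (closure_mono (Function.support_smul_subset_left _ _) hx)))
  · filter_upwards [h1] with x hx
    change χ x • g x = g x
    rw [hx, one_smul]

/-- Tangent vectors are separated by the derivatives of smooth functions. -/
theorem tangent_ext {x : M} {v w : TangentSpace I x}
    (h : ∀ u : C^∞⟮I, M; 𝓘(ℝ, ℝ), ℝ⟯, mvfderiv I u x v = mvfderiv I u x w) : v = w := by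
  have key (v w : EM) (h : ∀ u : C^∞⟮I, M; 𝓘(ℝ, ℝ), ℝ⟯,
      mvfderiv I u x (v : TangentSpace I x) = mvfderiv I u x (w : TangentSpace I x)) : v = w := by
    refine (SeparatingDual.eq_iff_forall_dual_eq (R := ℝ)).2 fun ℓ => ?_
    obtain ⟨u, hu⟩ := exists_contMDiffMap_eventuallyEq (I := I) (V := ℝ)
      (g := fun y => ℓ (extChartAt I x y)) (chart_source_mem_nhds H x) (fun y hy => by
        exact ContMDiffAt.comp y ℓ.contDiff.contMDiff.contMDiffAt (contMDiffAt_extChartAt' hy))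
    have h1 (z : EM) : mvfderiv I u x (z : TangentSpace I x) = ℓ z := by
      have : IsManifold I 1 M := IsManifold.of_le (n := ∞) (by simp)
      refine (mvfderiv_congr hu _).trans ((mvfderiv_clm_comp ℓ
        (mdifferentiableAt_extChartAt (mem_chart_source H x)) _).trans ?_)
      have h2 := mfderiv_extChartAt_self (I := I) (x := x)
      exact congrArg ℓ (DFunLike.congr_fun h2 z)
    exact (h1 v).symm.trans ((h u).trans (h1 w))
  exact key v w h

end Bump

/-! ### The bracket of a Lie algebroid in coordinates -/

section Sections

variable {EM : Type*} [NormedAddCommGroup EM] [NormedSpace ℝ EM] [FiniteDimensional ℝ EM]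
  {H : Type*} [TopologicalSpace H] {I : ModelWithCorners ℝ EM H}
  {M : Type*} [TopologicalSpace M] [ChartedSpace H M] [IsManifold I ∞ M] [T2Space M]
  {F : Type*} [NormedAddCommGroup F] [NormedSpace ℝ F]
  {E : M → Type*} [∀ x, AddCommGroup (E x)] [∀ x, Module ℝ (E x)]
  [∀ x, TopologicalSpace (E x)] [TopologicalSpace (TotalSpace F E)]
  [FiberBundle F E] [VectorBundle ℝ F E] [ContMDiffVectorBundle ∞ F E I]

variable (I F E) in
/-- Near every point there are global sections with prescribed constant coordinates, depending
linearly on these coordinates. -/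
theorem exists_constSection (x₀ : M) : ∃ S : F →ₗ[ℝ] Cₛ^∞⟮I; F, E⟯,
    ∀ᶠ x in 𝓝 x₀, ∀ w, fibreCoord F E x₀ x (S w x) = w := by
  obtain ⟨χ, h1, h2⟩ := exists_bump I (eventually_mem_baseSet F E x₀)
  let e := trivializationAt F E x₀
  have hsm (w : F) : ContMDiff I (I.prod 𝓘(ℝ, F)) ∞
      (fun x => (⟨x, χ x • e.symmL ℝ x w⟩ : TotalSpace F E)) := by
    refine contMDiff_along_cutoff (f := fun x => x) contMDiff_id χ.contMDiff fun x hx => ?_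
    have hx' : x ∈ e.baseSet := h2 hx
    refine (contMDiffAt_along_iff (f := fun x => x) hx').2 ⟨contMDiffAt_id, ?_⟩
    refine (contMDiffAt_const (c := w)).congr_of_eventuallyEq ?_
    filter_upwards [e.open_baseSet.mem_nhds hx'] with y hy
    exact e.continuousLinearMapAt_symmL hy w
  refine ⟨{ toFun := fun w => ⟨fun x => χ x • e.symmL ℝ x w, hsm w⟩
            map_add' := fun w w' => ?_
            map_smul' := fun r w => ?_ }, ?_⟩
  · ext x
    change χ x • e.symmL ℝ x (w + w') = χ x • e.symmL ℝ x w + χ x • e.symmL ℝ x w'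
    rw [map_add, smul_add]
  · ext x
    change χ x • e.symmL ℝ x (r • w) = r • χ x • e.symmL ℝ x w
    rw [map_smul, smul_comm]
  · filter_upwards [h1, eventually_mem_baseSet F E x₀] with x hx hx' w
    change fibreCoord F E x₀ x (χ x • e.symmL ℝ x w) = w
    rw [hx, one_smul]
    exact e.continuousLinearMapAt_symmL hx' w

variable (I F E) in
/-- The global section that has the constant coordinates `w` near `x₀`, in the preferred
trivialization at `x₀`. -/
def constSection (x₀ : M) : F →ₗ[ℝ] Cₛ^∞⟮I; F, E⟯ :=
  Classical.choose (exists_constSection I F E x₀)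

theorem eventually_fibreCoord_constSection (x₀ : M) :
    ∀ᶠ x in 𝓝 x₀, ∀ w, fibreCoord F E x₀ x (constSection I F E x₀ w x) = w :=
  Classical.choose_spec (exists_constSection I F E x₀)

theorem fibreCoord_constSection (x₀ : M) (w : F) :
    fibreCoord F E x₀ x₀ (constSection I F E x₀ w x₀) = w :=
  (eventually_fibreCoord_constSection x₀).self_of_nhds w

/-- The product of a smooth function and a smooth section. -/
def smulSection (f : C^∞⟮I, M; 𝓘(ℝ, ℝ), ℝ⟯) (X : Cₛ^∞⟮I; F, E⟯) : Cₛ^∞⟮I; F, E⟯ :=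
  ⟨fun x => f x • X x, fun x => contMDiffAt_along_smul (f := fun x => x) (f.contMDiff x)
    (X.contMDiff x)⟩

theorem contMDiffAt_fibreCoord (X : Cₛ^∞⟮I; F, E⟯) {x₀ x : M}
    (hx : x ∈ (trivializationAt F E x₀).baseSet) :
    ContMDiffAt I 𝓘(ℝ, F) ∞ (fun y => fibreCoord F E x₀ y (X y)) x :=
  ((contMDiffAt_along_iff (f := fun y => y) hx).1 (X.contMDiff x)).2

theorem mdifferentiableAt_fibreCoord (X : Cₛ^∞⟮I; F, E⟯) (x₀ : M) :
    MDifferentiableAt I 𝓘(ℝ, F) (fun y => fibreCoord F E x₀ y (X y)) x₀ :=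
  (contMDiffAt_fibreCoord X (FiberBundle.mem_baseSet_trivializationAt' x₀)).mdifferentiableAt
    (by simp)

variable (A : LieAlgebroid I F E)

namespace LieAlgebroid

theorem bracket_swap (X Y : Cₛ^∞⟮I; F, E⟯) : A.bracket X Y = -A.bracket Y X := by
  have h := A.bracket_self (X + Y)
  simp only [map_add, LinearMap.add_apply, A.bracket_self, zero_add, add_zero] at h
  exact eq_neg_of_add_eq_zero_right h

theorem bracket_smulSection (X Y : Cₛ^∞⟮I; F, E⟯) (f : C^∞⟮I, M; 𝓘(ℝ, ℝ), ℝ⟯) (x : M) :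
    A.bracket X (smulSection f Y) x =
      f x • A.bracket X Y x + mvfderiv I f x (A.anchor x (X x)) • Y x :=
  A.leibniz X Y (smulSection f Y) f (fun _ => rfl) x

/-- The bracket of sections is local: a section `Z` that vanishes near `x₀` satisfies `χ Z = 0` for
a bump function `χ`, and the Leibniz rule for `χ Z` gives `⟦X, Z⟧ = 0` at `x₀`. -/
theorem bracket_congr_right (X : Cₛ^∞⟮I; F, E⟯) {Y Y' : Cₛ^∞⟮I; F, E⟯} {x₀ : M}
    (h : ∀ᶠ x in 𝓝 x₀, Y x = Y' x) : A.bracket X Y x₀ = A.bracket X Y' x₀ := by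
  obtain ⟨χ, h1, h2⟩ := exists_bump I h
  have hz : smulSection χ (Y - Y') = 0 := by
    ext x
    change χ x • (Y x - Y' x) = 0
    by_cases hx : x ∈ tsupport χ
    · have : Y x = Y' x := h2 hx
      rw [this, sub_self, smul_zero]
    · rw [image_eq_zero_of_notMem_tsupport hx, zero_smul]
  have h3 := A.bracket_smulSection X (Y - Y') χ x₀
  have h4 : (Y - Y') x₀ = 0 := sub_eq_zero.2 h.self_of_nhds
  rw [hz, h1.self_of_nhds, h4, smul_zero, add_zero, one_smul, map_zero, map_sub] at h3
  exact (sub_eq_zero.1 h3.symm)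

/-- The anchor is compatible with the brackets:
`ρ(⟦X, Y⟧)(u) = ρ(X)(ρ(Y)(u)) - ρ(Y)(ρ(X)(u))`. This is a consequence of the Jacobi identity
applied to `X`, `Y` and `u Z`. -/
theorem mvfderiv_anchor_bracket (X Y : Cₛ^∞⟮I; F, E⟯) (u : C^∞⟮I, M; 𝓘(ℝ, ℝ), ℝ⟯) (x : M) :
    mvfderiv I u x (A.anchor x (A.bracket X Y x)) =
      mvfderiv I (fun y => mvfderiv I u y (A.anchor y (Y y))) x (A.anchor x (X x)) -
      mvfderiv I (fun y => mvfderiv I u y (A.anchor y (X y))) x (A.anchor x (Y x)) := by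
  have hsm (X : Cₛ^∞⟮I; F, E⟯) :
      ContMDiff I 𝓘(ℝ, ℝ) ∞ (fun y => mvfderiv I u y (A.anchor y (X y))) := fun y => by
    have h1 : ContMDiff I I.tangent ∞ (fun y => (⟨y, A.anchor y (X y)⟩ : TangentBundle I M)) :=
      A.contMDiff_anchor.comp X.contMDiff
    exact contMDiffAt_mvfderiv_apply (u.contMDiff y) (h1 y)
  let D (X : Cₛ^∞⟮I; F, E⟯) : C^∞⟮I, M; 𝓘(ℝ, ℝ), ℝ⟯ :=
    ⟨fun y => mvfderiv I u y (A.anchor y (X y)), hsm X⟩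
  -- if all sections vanish at `x`, the arguments of the derivatives are zero
  by_cases hZ : ∃ Z : Cₛ^∞⟮I; F, E⟯, Z x ≠ 0
  · obtain ⟨Z, hZ⟩ := hZ
    have hbr (X Y : Cₛ^∞⟮I; F, E⟯) : A.bracket Y (smulSection u Z) =
        smulSection u (A.bracket Y Z) + smulSection (D Y) Z := by
      ext y
      exact A.bracket_smulSection Y Z u y
    have hbr2 (X Y : Cₛ^∞⟮I; F, E⟯) : A.bracket X (A.bracket Y (smulSection u Z)) x =
        u x • A.bracket X (A.bracket Y Z) x + D X x • A.bracket Y Z x +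
          (D Y x • A.bracket X Z x + mvfderiv I (D Y) x (A.anchor x (X x)) • Z x) := by
      rw [hbr X Y, map_add]
      change A.bracket X (smulSection u (A.bracket Y Z)) x +
        A.bracket X (smulSection (D Y) Z) x = _
      rw [A.bracket_smulSection, A.bracket_smulSection]
      rfl
    have hj := DFunLike.congr_fun (A.jacobi X Y (smulSection u Z)) x
    have hj' := DFunLike.congr_fun (A.jacobi X Y Z) x
    rw [A.bracket_swap (smulSection u Z) X, A.bracket_swap (smulSection u Z), map_neg] at hj
    rw [A.bracket_swap Z X, A.bracket_swap Z, map_neg] at hj'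
    change A.bracket X (A.bracket Y (smulSection u Z)) x +
      -A.bracket Y (A.bracket X (smulSection u Z)) x +
      -A.bracket (A.bracket X Y) (smulSection u Z) x = 0 at hj
    change A.bracket X (A.bracket Y Z) x + -A.bracket Y (A.bracket X Z) x +
      -A.bracket (A.bracket X Y) Z x = 0 at hj'
    rw [hbr2, hbr2, A.bracket_smulSection] at hj
    have hfin : (mvfderiv I (D Y) x (A.anchor x (X x)) - mvfderiv I (D X) x (A.anchor x (Y x)) -
        mvfderiv I u x (A.anchor x (A.bracket X Y x))) • Z x = 0 := by
      rw [← hj, ← sub_eq_zero]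
      have h5 : u x • (A.bracket X (A.bracket Y Z) x + -A.bracket Y (A.bracket X Z) x +
        -A.bracket (A.bracket X Y) Z x) = 0 := by rw [hj', smul_zero]
      rw [← neg_eq_zero, ← h5]
      module
    have h6 := (smul_eq_zero.1 hfin).resolve_right hZ
    exact (sub_eq_zero.1 h6).symm
  · push Not at hZ
    simp [hZ]

variable [FiniteDimensional ℝ F]

/-- The bracket at `x₀` of sections with constant coordinates near `x₀`, as a bilinear map. -/
def localBracket (x₀ : M) : F →ₗ[ℝ] F →ₗ[ℝ] F :=
  (A.bracket.compl₁₂ (constSection I F E x₀) (constSection I F E x₀)).compr₂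
    { toFun := fun X => fibreCoord F E x₀ x₀ (X x₀)
      map_add' := fun X Y => (fibreCoord F E x₀ x₀).map_add (X x₀) (Y x₀)
      map_smul' := fun r X => (fibreCoord F E x₀ x₀).map_smul r (X x₀) }

/-- The dependence of the bracket on the coordinates of its second argument. -/
theorem fibreCoord_bracket_right (X Y : Cₛ^∞⟮I; F, E⟯) (x₀ : M) :
    fibreCoord F E x₀ x₀ (A.bracket X Y x₀) =
      fibreCoord F E x₀ x₀ (A.bracket X
        (constSection I F E x₀ (fibreCoord F E x₀ x₀ (Y x₀))) x₀) +
      mvfderiv I (fun y => fibreCoord F E x₀ y (Y y)) x₀ (A.anchor x₀ (X x₀)) := by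
  let b := Module.finBasis ℝ F
  let η : M → F := fun y => fibreCoord F E x₀ y (Y y)
  let ℓ (q) : F →L[ℝ] ℝ := LinearMap.toContinuousLinearMap (b.coord q)
  have hη : ∀ x ∈ (trivializationAt F E x₀).baseSet, ContMDiffAt I 𝓘(ℝ, F) ∞ η x :=
    fun x hx => contMDiffAt_fibreCoord Y hx
  have hηx : MDifferentiableAt I 𝓘(ℝ, F) η x₀ := mdifferentiableAt_fibreCoord Y x₀
  choose f hf using fun q => exists_contMDiffMap_eventuallyEq (I := I)
    (eventually_mem_baseSet F E x₀) (g := fun y => ℓ q (η y))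
    (fun x hx => by exact (ℓ q).contDiff.contMDiff.contMDiffAt.comp x (hη x hx))
  let S (q) := constSection I F E x₀ (b q)
  have hsum : ∀ᶠ x in 𝓝 x₀, Y x = (∑ q, smulSection (f q) (S q)) x := by
    filter_upwards [Filter.eventually_all.2 hf,
      eventually_fibreCoord_constSection (I := I) (F := F) (E := E) x₀,
      eventually_mem_baseSet F E x₀] with x h1 h2 h3
    apply fibreCoord_injective h3
    have h4 : (∑ q, smulSection (f q) (S q)) x = ∑ q, f q x • S q x := by
      rw [← ContMDiffSection.coeAddHom_apply, map_sum, Finset.sum_apply]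
      rfl
    rw [h4, map_sum]
    simp only [map_smul, h1, S, h2]
    exact (b.sum_repr (η x)).symm
  rw [A.bracket_congr_right X hsum, map_sum]
  have h5 : (∑ q, A.bracket X (smulSection (f q) (S q))) x₀ =
      ∑ q, A.bracket X (smulSection (f q) (S q)) x₀ := by
    rw [← ContMDiffSection.coeAddHom_apply, map_sum, Finset.sum_apply]
    rfl
  rw [h5]
  simp only [A.bracket_smulSection, Finset.sum_add_distrib, map_add, map_sum, map_smul]
  congr 1
  · have h6 : constSection I F E x₀ (fibreCoord F E x₀ x₀ (Y x₀)) = ∑ q, f q x₀ • S q := by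
      rw [← b.sum_repr (fibreCoord F E x₀ x₀ (Y x₀)), map_sum]
      refine Finset.sum_congr rfl fun q _ => ?_
      rw [map_smul, (hf q).self_of_nhds]
      rfl
    have h7 : (∑ q, A.bracket X (f q x₀ • S q)) x₀ =
        ∑ q, f q x₀ • A.bracket X (S q) x₀ := by
      rw [← ContMDiffSection.coeAddHom_apply, map_sum, Finset.sum_apply]
      refine Finset.sum_congr rfl fun q _ => ?_
      rw [map_smul]
      rfl
    rw [h6, map_sum, h7, map_sum]
    simp only [map_smul]
  · have h8 (q) : mvfderiv I (f q) x₀ (A.anchor x₀ (X x₀)) =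
        b.repr (mvfderiv I η x₀ (A.anchor x₀ (X x₀))) q := by
      rw [mvfderiv_congr (hf q), mvfderiv_clm_comp (ℓ q) hηx]
      rfl
    simp only [h8, S, fibreCoord_constSection]
    exact b.sum_repr _

/-- The bracket of sections of `E` in coordinates. -/
theorem fibreCoord_bracket (X Y : Cₛ^∞⟮I; F, E⟯) (x₀ : M) :
    fibreCoord F E x₀ x₀ (A.bracket X Y x₀) =
      A.localBracket x₀ (fibreCoord F E x₀ x₀ (X x₀)) (fibreCoord F E x₀ x₀ (Y x₀)) +
      mvfderiv I (fun y => fibreCoord F E x₀ y (Y y)) x₀ (A.anchor x₀ (X x₀)) -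
      mvfderiv I (fun y => fibreCoord F E x₀ y (X y)) x₀ (A.anchor x₀ (Y x₀)) := by
  set Y' := constSection I F E x₀ (fibreCoord F E x₀ x₀ (Y x₀)) with hY'
  have hYY : Y' x₀ = Y x₀ :=
    fibreCoord_injective (FiberBundle.mem_baseSet_trivializationAt' x₀)
      (fibreCoord_constSection x₀ _)
  have hneg (Z W : Cₛ^∞⟮I; F, E⟯) : A.bracket Z W x₀ = -A.bracket W Z x₀ := by
    rw [A.bracket_swap]
    rfl
  -- replace `Y` by `Y'`, then `X` by a section with constant coordinates, using antisymmetry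
  rw [A.fibreCoord_bracket_right X Y, ← hY', hneg X Y', map_neg,
    A.fibreCoord_bracket_right Y' X, hYY, hneg Y', map_neg]
  change _ = fibreCoord F E x₀ x₀
      (A.bracket (constSection I F E x₀ (fibreCoord F E x₀ x₀ (X x₀))) Y' x₀) + _ - _
  abel

end LieAlgebroid

end Sections

/-! ### The bracket of sections of a prolongation -/

section Prolongation

variable {EM : Type*} [NormedAddCommGroup EM] [NormedSpace ℝ EM] [FiniteDimensional ℝ EM]
  {H : Type*} [TopologicalSpace H] {I : ModelWithCorners ℝ EM H}
  {M : Type*} [TopologicalSpace M] [ChartedSpace H M] [IsManifold I ∞ M] [T2Space M]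
  {F : Type*} [NormedAddCommGroup F] [NormedSpace ℝ F] [FiniteDimensional ℝ F]
  {E : M → Type*} [∀ x, AddCommGroup (E x)] [∀ x, Module ℝ (E x)]
  [∀ x, TopologicalSpace (E x)] [TopologicalSpace (TotalSpace F E)]
  [FiberBundle F E] [VectorBundle ℝ F E] [ContMDiffVectorBundle ∞ F E I]
  {EM' : Type*} [NormedAddCommGroup EM'] [NormedSpace ℝ EM']
  {H' : Type*} [TopologicalSpace H'] {I' : ModelWithCorners ℝ EM' H'}
  {M' : Type*} [TopologicalSpace M'] [ChartedSpace H' M'] [IsManifold I' ∞ M']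
  {A : LieAlgebroid I F E} {f : M' → M}

theorem dirDeriv_eq_mvfderiv (g : M' → ℝ) (x : M') (v : TangentSpace I' x) :
    dirDeriv I' g x v = mvfderiv I' g x v := rfl

/-- The product and chain rules for a combination `∑ⱼ sⱼ (gⱼ ∘ f)`. -/
theorem mvfderiv_sum_smul_comp {V : Type*} [NormedAddCommGroup V] [NormedSpace ℝ V]
    {ι : Type*} [Fintype ι] {s : ι → M' → ℝ} {g : ι → M → V} {x : M'}
    (hs : ∀ j, MDifferentiableAt I' 𝓘(ℝ, ℝ) (s j) x)
    (hg : ∀ j, MDifferentiableAt I 𝓘(ℝ, V) (g j) (f x))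
    (hf : MDifferentiableAt I' I f x) (v : TangentSpace I' x) :
    mvfderiv I' (fun y => ∑ j, s j y • g j (f y)) x v =
      ∑ j, mvfderiv I' (s j) x v • g j (f x) +
        ∑ j, s j x • mvfderiv I (g j) (f x) (mfderiv I' I f x v) := by
  have hgf (j) : MDifferentiableAt I' 𝓘(ℝ, V) (fun y => g j (f y)) x := (hg j).comp x hf
  rw [mvfderiv_sum (u := fun j y => s j y • g j (f y)) _ (fun j _ => (hs j).smul (hgf j)),
    ← Finset.sum_add_distrib]
  refine Finset.sum_congr rfl fun j _ => ?_
  have h1 := DFunLike.congr_fun (mvfderiv_smul (hs j) (hgf j)) v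
  refine h1.trans ?_
  change s j x • mvfderiv I' (fun y => g j (f y)) x v + mvfderiv I' (s j) x v • g j (f x) = _
  rw [add_comm, mvfderiv_comp_of_eq_apply (hg j) hf rfl]

theorem ProlongSection.contMDiffAt_fibreCoord (X : ProlongSection I' A f) {x₀ : M} {x : M'}
    (hx : f x ∈ (trivializationAt F E x₀).baseSet) :
    ContMDiffAt I' 𝓘(ℝ, F) ∞ (fun y => fibreCoord F E x₀ (f y) (X.fst y)) x :=
  ((contMDiffAt_along_iff hx).1 (X.contMDiff_fst x)).2

/-- Near every point, the first component of a section is a combination `∑ᵢ hᵢ (Xᵢ ∘ f)`. -/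
theorem ProlongSection.exists_fst_eq_sum (hf : ContMDiff I' I ∞ f) (X : ProlongSection I' A f)
    (x : M') : ∃ (n : ℕ) (h : Fin n → C^∞⟮I', M'; 𝓘(ℝ, ℝ), ℝ⟯) (Xs : Fin n → Cₛ^∞⟮I; F, E⟯),
      ∀ᶠ y in 𝓝 x, X.fst y = ∑ i, h i y • Xs i (f y) := by
  let b := Module.finBasis ℝ F
  let ℓ (q) : F →L[ℝ] ℝ := LinearMap.toContinuousLinearMap (b.coord q)
  let ξ : M' → F := fun y => fibreCoord F E (f x) (f y) (X.fst y)
  obtain ⟨χ, h1, h2⟩ := exists_bump I (eventually_mem_baseSet F E (f x))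
  have hξ (y : M') (hy : f y ∈ (trivializationAt F E (f x)).baseSet) :
      ContMDiffAt I' 𝓘(ℝ, F) ∞ ξ y := X.contMDiffAt_fibreCoord hy
  have hsm (q) : ContMDiff I' 𝓘(ℝ, ℝ) ∞ (fun y => χ (f y) * ℓ q (ξ y)) := by
    refine contMDiff_of_tsupport fun y hy => ?_
    have hy1 : y ∈ tsupport (fun y => χ (f y)) :=
      closure_mono (Function.support_mul_subset_left _ _) hy
    have hy2 : f y ∈ tsupport χ :=
      closure_minimal (s := Function.support fun y => χ (f y)) (t := f ⁻¹' tsupport χ)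
        (fun z hz => subset_tsupport χ hz)
        ((isClosed_tsupport χ).preimage hf.continuous) hy1
    exact ((χ.contMDiff.comp hf) y).mul
      ((ℓ q).contDiff.contMDiff.contMDiffAt.comp y (hξ y (h2 hy2)))
  refine ⟨_, fun q => ⟨_, hsm q⟩, fun q => constSection I F E (f x) (b q), ?_⟩
  filter_upwards [hf.continuous.continuousAt.eventually h1,
    hf.continuous.continuousAt.eventually
      (eventually_fibreCoord_constSection (I := I) (F := F) (E := E) (f x)),
    hf.continuous.continuousAt.eventually (eventually_mem_baseSet F E (f x))] with y hy1 hy2 hy3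
  apply fibreCoord_injective hy3
  rw [map_sum]
  simp only [map_smul, hy2]
  change ξ y = ∑ q, (χ (f y) * ℓ q (ξ y)) • b q
  simp only [hy1, one_mul]
  exact (b.sum_repr (ξ y)).symm

variable (X Y : ProlongSection I' A f)

/-- The first component of the bracket of two sections, by its formula in the preferred
trivialization of `E` at `f x`. The trivialization changes with `x`, so that smoothness is not
evident; it follows from `bracketFst_eq_sum`. -/
def bracketFst (x : M') : E (f x) :=
  (trivializationAt F E (f x)).symmL ℝ (f x)
    (A.localBracket (f x) (fibreCoord F E (f x) (f x) (X.fst x))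
        (fibreCoord F E (f x) (f x) (Y.fst x)) +
      mvfderiv I' (fun y => fibreCoord F E (f x) (f y) (Y.fst y)) x (X.snd x) -
      mvfderiv I' (fun y => fibreCoord F E (f x) (f y) (X.fst y)) x (Y.snd x))

theorem fibreCoord_bracketFst (x : M') :
    fibreCoord F E (f x) (f x) (bracketFst X Y x) =
      A.localBracket (f x) (fibreCoord F E (f x) (f x) (X.fst x))
        (fibreCoord F E (f x) (f x) (Y.fst x)) +
      mvfderiv I' (fun y => fibreCoord F E (f x) (f y) (Y.fst y)) x (X.snd x) -
      mvfderiv I' (fun y => fibreCoord F E (f x) (f y) (X.fst y)) x (Y.snd x) :=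
  Trivialization.continuousLinearMapAt_symmL _ (FiberBundle.mem_baseSet_trivializationAt' (f x)) _

variable {X Y}

theorem anchor_fst_eq_sum {p : ℕ} {x : M'} {h : Fin p → C^∞⟮I', M'; 𝓘(ℝ, ℝ), ℝ⟯}
    {Xs : Fin p → Cₛ^∞⟮I; F, E⟯} (hX : X.fst x = ∑ i, h i x • Xs i (f x)) :
    mfderiv I' I f x (X.snd x) = ∑ i, h i x • A.anchor (f x) (Xs i (f x)) := by
  rw [← X.compat, hX, map_sum]
  simp only [map_smul]

/-- The bracket formula gives the same value for all local representations of the first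
components. -/
theorem bracketFst_eq_sum (hf : ContMDiff I' I ∞ f) {x : M'} {p q : ℕ}
    {h : Fin p → C^∞⟮I', M'; 𝓘(ℝ, ℝ), ℝ⟯} {Xs : Fin p → Cₛ^∞⟮I; F, E⟯}
    {s : Fin q → C^∞⟮I', M'; 𝓘(ℝ, ℝ), ℝ⟯} {Ys : Fin q → Cₛ^∞⟮I; F, E⟯}
    (hX : ∀ᶠ y in 𝓝 x, X.fst y = ∑ i, h i y • Xs i (f y))
    (hY : ∀ᶠ y in 𝓝 x, Y.fst y = ∑ j, s j y • Ys j (f y)) :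
    bracketFst X Y x = ∑ i, ∑ j, (h i x * s j x) • A.bracket (Xs i) (Ys j) (f x)
      + ∑ j, dirDeriv I' (s j) x (X.snd x) • Ys j (f x)
      - ∑ i, dirDeriv I' (h i) x (Y.snd x) • Xs i (f x) := by
  apply fibreCoord_injective (F := F) (FiberBundle.mem_baseSet_trivializationAt' (f x))
  have hfx : MDifferentiableAt I' I f x := hf.mdifferentiableAt (by simp)
  have hmap {p : ℕ} {X : ProlongSection I' A f} {h : Fin p → C^∞⟮I', M'; 𝓘(ℝ, ℝ), ℝ⟯}
      {Xs : Fin p → Cₛ^∞⟮I; F, E⟯} (hX : ∀ᶠ y in 𝓝 x, X.fst y = ∑ i, h i y • Xs i (f y)) :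
      ∀ᶠ y in 𝓝 x, fibreCoord F E (f x) (f y) (X.fst y) =
        ∑ i, h i y • (fun z => fibreCoord F E (f x) z (Xs i z)) (f y) := by
    filter_upwards [hX] with y hy
    rw [hy, map_sum]
    simp only [map_smul]
  rw [fibreCoord_bracketFst, mvfderiv_congr (hmap hX), mvfderiv_congr (hmap hY),
    (hmap hX).self_of_nhds, (hmap hY).self_of_nhds,
    mvfderiv_sum_smul_comp (fun j => (s j).mdifferentiableAt)
      (fun j => mdifferentiableAt_fibreCoord (Ys j) (f x)) hfx,
    mvfderiv_sum_smul_comp (fun j => (h j).mdifferentiableAt)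
      (fun j => mdifferentiableAt_fibreCoord (Xs j) (f x)) hfx,
    anchor_fst_eq_sum hX.self_of_nhds, anchor_fst_eq_sum hY.self_of_nhds]
  simp only [map_sum, map_smul, map_add, map_sub, A.fibreCoord_bracket, LinearMap.sum_apply,
    LinearMap.smul_apply, Finset.smul_sum, smul_add, smul_sub, smul_smul, Finset.sum_add_distrib,
    Finset.sum_sub_distrib, dirDeriv_eq_mvfderiv]
  rw [Finset.sum_comm (f := fun j i => (s j x * h i x) •
    mvfderiv I (fun z => fibreCoord F E (f x) z (Ys j z)) (f x) (A.anchor (f x) (Xs i (f x))))]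
  rw [Finset.sum_comm (f := fun j i => (s j x * h i x) •
    A.localBracket (f x) (fibreCoord F E (f x) (f x) (Xs i (f x)))
      (fibreCoord F E (f x) (f x) (Ys j (f x))))]
  simp only [mul_comm (s _ x)]
  abel

theorem contMDiff_bracketFst (hf : ContMDiff I' I ∞ f) (X Y : ProlongSection I' A f) :
    ContMDiff I' (I.prod 𝓘(ℝ, F)) ∞
      (fun x => (⟨f x, bracketFst X Y x⟩ : TotalSpace F E)) := by
  intro x
  obtain ⟨p, h, Xs, hX⟩ := X.exists_fst_eq_sum hf x
  obtain ⟨q, s, Ys, hY⟩ := Y.exists_fst_eq_sum hf x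
  have hev : ∀ᶠ y in 𝓝 x, bracketFst X Y y =
      ∑ i, ∑ j, (h i y * s j y) • A.bracket (Xs i) (Ys j) (f y)
      + ∑ j, dirDeriv I' (s j) y (X.snd y) • Ys j (f y)
      + ∑ i, (-dirDeriv I' (h i) y (Y.snd y)) • Xs i (f y) := by
    filter_upwards [hX.eventually_nhds, hY.eventually_nhds] with y hy1 hy2
    rw [bracketFst_eq_sum hf hy1 hy2]
    simp only [neg_smul, Finset.sum_neg_distrib, sub_eq_add_neg]
  have hsec (Z : Cₛ^∞⟮I; F, E⟯) : ContMDiffAt I' (I.prod 𝓘(ℝ, F)) ∞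
      (fun y => (⟨f y, Z (f y)⟩ : TotalSpace F E)) x := contMDiffAt_section_comp Z (hf x)
  have hd (u : C^∞⟮I', M'; 𝓘(ℝ, ℝ), ℝ⟯) (Z : ProlongSection I' A f) :
      ContMDiffAt I' 𝓘(ℝ, ℝ) ∞ (fun y => dirDeriv I' u y (Z.snd y)) x :=
    contMDiffAt_mvfderiv_apply (u.contMDiff x) (Z.contMDiff_snd x)
  have h1 : ContMDiffAt I' (I.prod 𝓘(ℝ, F)) ∞ (fun y => (⟨f y,
      ∑ i, ∑ j, (h i y * s j y) • A.bracket (Xs i) (Ys j) (f y)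
      + ∑ j, dirDeriv I' (s j) y (X.snd y) • Ys j (f y)
      + ∑ i, (-dirDeriv I' (h i) y (Y.snd y)) • Xs i (f y)⟩ : TotalSpace F E)) x := by
    refine contMDiffAt_along_add (contMDiffAt_along_add ?_ ?_) ?_
    · refine contMDiffAt_along_sum _ (hf x) fun i _ => contMDiffAt_along_sum _ (hf x) fun j _ => ?_
      exact contMDiffAt_along_smul (((h i).contMDiff x).mul ((s j).contMDiff x)) (hsec _)
    · exact contMDiffAt_along_sum _ (hf x) fun j _ =>
        contMDiffAt_along_smul (hd _ _) (hsec _)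
    · exact contMDiffAt_along_sum _ (hf x) fun j _ =>
        contMDiffAt_along_smul (hd _ _).neg (hsec _)
  refine h1.congr_of_eventuallyEq ?_
  filter_upwards [hev] with y hy
  rw [hy]

variable [CompleteSpace EM'] [I'.Boundaryless]

/-- The value of the bracket formula lies in the prolongation: its anchor is the image of the Lie
bracket of the second components. -/
theorem anchor_bracketFst (hf : ContMDiff I' I ∞ f) (X Y : ProlongSection I' A f) (x : M') :
    A.anchor (f x) (bracketFst X Y x) =
      mfderiv I' I f x (VectorField.mlieBracket I' X.snd Y.snd x) := by
  -- both sides act on functions `u` on `M` as the commutator of the derivations `X'`, `Y'`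
  refine tangent_ext fun u => ?_
  obtain ⟨p, h, Xs, hX⟩ := X.exists_fst_eq_sum hf x
  obtain ⟨q, s, Ys, hY⟩ := Y.exists_fst_eq_sum hf x
  have hfx (y : M') : MDifferentiableAt I' I f y := hf.mdifferentiableAt (by simp)
  have huf : ContMDiff I' 𝓘(ℝ, ℝ) ∞ (fun y => u (f y)) := u.contMDiff.comp hf
  have hmap {p : ℕ} {X : ProlongSection I' A f} {h : Fin p → C^∞⟮I', M'; 𝓘(ℝ, ℝ), ℝ⟯}
      {Xs : Fin p → Cₛ^∞⟮I; F, E⟯} (hX : ∀ᶠ y in 𝓝 x, X.fst y = ∑ i, h i y • Xs i (f y)) :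
      ∀ᶠ y in 𝓝 x, mvfderiv I' (fun y => u (f y)) y (X.snd y) =
        ∑ i, h i y • (fun z => mvfderiv I u z (A.anchor z (Xs i z))) (f y) := by
    filter_upwards [hX] with y hy
    rw [mvfderiv_comp_of_eq_apply (J' := I) (u := u) u.mdifferentiableAt (hfx y) rfl]
    refine (congrArg (mvfderiv I u (f y)) (anchor_fst_eq_sum hy)).trans ?_
    rw [map_sum]
    simp only [map_smul]
  have hD (Z : Cₛ^∞⟮I; F, E⟯) : MDifferentiableAt I 𝓘(ℝ, ℝ)
      (fun z => mvfderiv I u z (A.anchor z (Z z))) (f x) := by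
    have h1 : ContMDiff I I.tangent ∞ (fun y => (⟨y, A.anchor y (Z y)⟩ : TangentBundle I M)) :=
      A.contMDiff_anchor.comp Z.contMDiff
    exact (contMDiffAt_mvfderiv_apply (u.contMDiff _) (h1 _)).mdifferentiableAt (by simp)
  have hrhs : mvfderiv I u (f x)
      (mfderiv I' I f x (VectorField.mlieBracket I' X.snd Y.snd x)) = _ :=
    (mvfderiv_comp_of_eq_apply (J' := I) (u := u) u.mdifferentiableAt (hfx x) rfl _).symm.trans
      (mvfderiv_mlieBracket (X.contMDiff_snd x) (Y.contMDiff_snd x) (huf x))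
  rw [hrhs, mvfderiv_congr (hmap hX), mvfderiv_congr (hmap hY),
    mvfderiv_sum_smul_comp (fun j => (s j).mdifferentiableAt) (fun j => hD (Ys j)) (hfx x),
    mvfderiv_sum_smul_comp (fun j => (h j).mdifferentiableAt) (fun j => hD (Xs j)) (hfx x),
    anchor_fst_eq_sum hX.self_of_nhds, anchor_fst_eq_sum hY.self_of_nhds,
    bracketFst_eq_sum hf hX hY]
  simp only [map_sum, map_smul, map_add, map_sub, A.mvfderiv_anchor_bracket,
    Finset.smul_sum, smul_sub, smul_smul,
    Finset.sum_sub_distrib, dirDeriv_eq_mvfderiv]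
  rw [Finset.sum_comm (f := fun j i => (s j x * h i x) •
    mvfderiv I (fun z => mvfderiv I u z (A.anchor z (Ys j z))) (f x)
      (A.anchor (f x) (Xs i (f x))))]
  simp only [mul_comm (s _ x)]
  abel

/-- The bracket of sections of a prolongation exists: `prolongBracket` satisfies its defining
formula. -/
theorem isProlongBracket_prolongBracket (hf : ContMDiff I' I ∞ f) (X Y : ProlongSection I' A f) :
    IsProlongBracket X Y (prolongBracket X Y) := by
  have : IsManifold I' (minSmoothness ℝ 2) M' := by
    rw [minSmoothness_of_isRCLikeNormedField]
    exact IsManifold.of_le (n := ∞) (WithTop.coe_le_coe.2 (le_top : (2 : ℕ∞) ≤ ⊤))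
  have : IsManifold I' (∞ + 1) M' := IsManifold.of_le (n := ∞) (by simp)
  have hsnd : ContMDiff I' I'.tangent ∞ (fun x => (⟨x, VectorField.mlieBracket I' X.snd Y.snd x⟩ :
      TangentBundle I' M')) :=
    ContDiff.mlieBracket_vectorField (m := ⊤) (n := ⊤) X.contMDiff_snd Y.contMDiff_snd (by simp)
  have hex : ∃ C : ProlongSection I' A f, IsProlongBracket X Y C :=
    ⟨⟨bracketFst X Y, _, contMDiff_bracketFst hf X Y, hsnd, anchor_bracketFst hf X Y⟩,
      fun _ => rfl, fun _ _ _ _ _ _ _ hX hY => bracketFst_eq_sum hf hX hY⟩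
  exact Classical.epsilon_spec hex

theorem prolongBracket_snd (hf : ContMDiff I' I ∞ f) (X Y : ProlongSection I' A f) (x : M') :
    (prolongBracket X Y).snd x = VectorField.mlieBracket I' X.snd Y.snd x :=
  (isProlongBracket_prolongBracket hf X Y).1 x

theorem prolongBracket_fst (hf : ContMDiff I' I ∞ f) (X Y : ProlongSection I' A f) (x : M') :
    (prolongBracket X Y).fst x = bracketFst X Y x := by
  obtain ⟨p, h, Xs, hX⟩ := X.exists_fst_eq_sum hf x
  obtain ⟨q, s, Ys, hY⟩ := Y.exists_fst_eq_sum hf x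
  rw [(isProlongBracket_prolongBracket hf X Y).2 x p q h Xs s Ys hX hY, bracketFst_eq_sum hf hX hY]

end Prolongation

/-! ### Alternating sums of derivatives -/

section Alternating

variable {V : Type*} [NormedAddCommGroup V] [NormedSpace ℝ V]
  {EN : Type*} [NormedAddCommGroup EN] [NormedSpace ℝ EN]
  {HN : Type*} [TopologicalSpace HN] {J : ModelWithCorners ℝ EN HN}
  {N : Type*} [TopologicalSpace N] [ChartedSpace HN N]

/-- The product rule for the value of an alternating map on vectors. -/
theorem mvfderiv_alternating_apply {n : ℕ} {m : N → V [⋀^Fin n]→L[ℝ] ℝ} {g : Fin n → N → V}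
    {x : N} (hm : MDifferentiableAt J 𝓘(ℝ, V [⋀^Fin n]→L[ℝ] ℝ) m x)
    (hg : ∀ k, MDifferentiableAt J 𝓘(ℝ, V) (g k) x) (v : TangentSpace J x) :
    mvfderiv J (fun y => m y (g · y)) x v =
      (mvfderiv J m x v : V [⋀^Fin n]→L[ℝ] ℝ) (g · x) +
        ∑ k, m x (Function.update (g · x) k (mvfderiv J (g k) x v)) := by
  let P : (V [⋀^Fin n]→L[ℝ] ℝ) × (Fin n → V) → ℝ := fun p => p.1 p.2
  let u : N → (V [⋀^Fin n]→L[ℝ] ℝ) × (Fin n → V) := fun y => (m y, (g · y))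
  let π₂ (k) : (V [⋀^Fin n]→L[ℝ] ℝ) × (Fin n → V) →L[ℝ] V :=
    (ContinuousLinearMap.proj k).comp (ContinuousLinearMap.snd ℝ _ _)
  have hu : MDifferentiableAt J 𝓘(ℝ, (V [⋀^Fin n]→L[ℝ] ℝ) × (Fin n → V)) u x :=
    hm.prodMk_space ((mdifferentiableAt_iff _ _).2 ⟨continuousAt_pi.2 fun k => (hg k).continuousAt,
      differentiableWithinAt_pi.2 fun k => ((mdifferentiableAt_iff _ _).1 (hg k)).2⟩)
  have hd (k) : DifferentiableAt ℝ (fun p : (V [⋀^Fin n]→L[ℝ] ℝ) × (Fin n → V) => p.2 k) (u x) :=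
    (π₂ k).differentiableAt
  have hP : DifferentiableAt ℝ P (u x) :=
    DifferentiableAt.continuousAlternatingMap_apply
      (g := fun k (p : (V [⋀^Fin n]→L[ℝ] ℝ) × (Fin n → V)) => p.2 k) differentiableAt_fst hd
  have h1 : mvfderiv J (fun y => m y (g · y)) x v = fderiv ℝ P (u x) (mvfderiv J u x v) :=
    (mvfderiv_comp_of_eq_apply (u := P) hP.mdifferentiableAt hu rfl v).trans
      (mvfderiv_eq_fderiv P (u x) _)
  have h2 (w) : fderiv ℝ P (u x) w = w.1 (g · x) +
      ∑ k, m x (Function.update (g · x) k (w.2 k)) := by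
    have := fderiv_continuousAlternatingMap_apply_apply (𝕜 := ℝ)
      (g := fun k (p : (V [⋀^Fin n]→L[ℝ] ℝ) × (Fin n → V)) => p.2 k)
      (f := fun p : (V [⋀^Fin n]→L[ℝ] ℝ) × (Fin n → V) => p.1)
      differentiableAt_fst hd w
    refine this.trans ?_
    have h3 (k) : fderiv ℝ (fun p : (V [⋀^Fin n]→L[ℝ] ℝ) × (Fin n → V) => p.2 k) (u x) = π₂ k :=
      (π₂ k).fderiv
    simp only [h3, fderiv_fst]
    rfl
  rw [h1, h2]
  congr 1
  · have := mvfderiv_clm_comp (ContinuousLinearMap.fst ℝ (V [⋀^Fin n]→L[ℝ] ℝ) (Fin n → V)) hu v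
    exact congrArg (fun w : V [⋀^Fin n]→L[ℝ] ℝ => w (g · x)) this.symm
  · refine Finset.sum_congr rfl fun k _ => ?_
    exact congrArg (fun w => m x (Function.update (g · x) k w)) (mvfderiv_clm_comp (π₂ k) hu v).symm

/-- The cancellation behind the invariance of the differential: the derivatives `D i l` of the
`l`-th argument in the direction `i` cancel against the derivatives in the brackets. -/
theorem alternating_sum_cancel {n : ℕ} (m : V [⋀^Fin (n + 1)]→L[ℝ] ℝ) (g : Fin (n + 2) → V)
    (D : Fin (n + 2) → Fin (n + 2) → V) :
    ∑ i : Fin (n + 2), (-1 : ℝ) ^ (i : ℕ) *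
        ∑ k, m (Function.update (i.removeNth g) k (D i (i.succAbove k))) =
      - ∑ i : Fin (n + 1), ∑ j : Fin (n + 1), if i ≤ j then
        (-1 : ℝ) ^ ((i : ℕ) + ((j : ℕ) + 1)) *
          m (Fin.cons (D i.castSucc j.succ - D j.succ i.castSucc)
            (j.removeNth (i.castSucc.removeNth g)))
        else 0 := by
  have hI (i : Fin (n + 1)) (f : Fin (n + 1) → ℝ) :
      ∑ j, (if i ≤ j then f j else 0) = ∑ j ∈ Finset.Ici i, f j := by
    rw [← Finset.sum_filter]
    congr 1
    ext j
    simp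
  have hcons (w : V) (t : Fin n → V) : m (Fin.cons w t) = m (Matrix.vecCons w t) := rfl
  simp only [hI, hcons, Finset.mul_sum, ← Finset.sum_neg_distrib]
  rw [Fin.sum_sum_eq_sum_triangle_add]
  refine Fintype.sum_congr _ _ fun i => Finset.sum_congr rfl fun j hj => ?_
  rw [Finset.mem_Ici] at hj
  simp only [← Fin.insertNth_removeNth, ContinuousAlternatingMap.map_insertNth]
  rw [Fin.removeNth_removeNth_eq_swap]
  have H₁ : i.castSucc.succAbove j = j.succ := by simp [Fin.succAbove_of_le_castSucc, hj]
  have H₂ : j.predAbove i.castSucc = i := by simp [Fin.predAbove_of_le_castSucc, hj]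
  have H₃ : j.succ.succAbove i = i.castSucc := by simp [Fin.succAbove_of_castSucc_lt, hj]
  simp only [H₁, H₂, H₃, sub_eq_add_neg, Matrix.vecCons]
  have hsub (w w' : V) (t : Fin n → V) :
      m (Fin.cons (w + -w') t) = m (Fin.cons w t) - m (Fin.cons w' t) := by
    have := m.toAlternatingMap.toMultilinearMap.cons_add t w (-w')
    have h2 := m.toAlternatingMap.toMultilinearMap.cons_smul t (-1 : ℝ) w'
    simp only [neg_smul, one_smul, smul_eq_mul, neg_mul, one_mul] at h2
    refine this.trans ?_
    rw [h2, sub_eq_add_neg]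
    rfl
  rw [hsub]
  simp only [Fin.val_castSucc, Fin.val_succ, pow_add, pow_one]
  ring

/-- The alternating sum that defines the differential, for arguments whose "brackets" consist of a
term `b i j` and of the derivatives of the arguments along each other: the derivatives of the
arguments drop out. -/
theorem sum_mvfderiv_alternating {n : ℕ} {m : N → V [⋀^Fin (n + 1)]→L[ℝ] ℝ}
    {g : Fin (n + 2) → N → V} {x : N}
    (hm : MDifferentiableAt J 𝓘(ℝ, V [⋀^Fin (n + 1)]→L[ℝ] ℝ) m x)
    (hg : ∀ k, MDifferentiableAt J 𝓘(ℝ, V) (g k) x) (v : Fin (n + 2) → TangentSpace J x)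
    (b : Fin (n + 2) → Fin (n + 2) → V) :
    ∑ i : Fin (n + 2), (-1 : ℝ) ^ (i : ℕ) *
        mvfderiv J (fun y => m y (i.removeNth (g · y))) x (v i) +
      ∑ i : Fin (n + 1), ∑ j : Fin (n + 1), (if i ≤ j then
        (-1 : ℝ) ^ ((i : ℕ) + ((j : ℕ) + 1)) *
          m x (Fin.cons (b i.castSucc j.succ + mvfderiv J (g j.succ) x (v i.castSucc) -
              mvfderiv J (g i.castSucc) x (v j.succ))
            (j.removeNth (i.castSucc.removeNth (g · x))))
        else 0) =
    ∑ i : Fin (n + 2), (-1 : ℝ) ^ (i : ℕ) *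
        (mvfderiv J m x (v i) : V [⋀^Fin (n + 1)]→L[ℝ] ℝ) (i.removeNth (g · x)) +
      ∑ i : Fin (n + 1), ∑ j : Fin (n + 1), (if i ≤ j then
        (-1 : ℝ) ^ ((i : ℕ) + ((j : ℕ) + 1)) *
          m x (Fin.cons (b i.castSucc j.succ) (j.removeNth (i.castSucc.removeNth (g · x))))
        else 0) := by
  have h1 (i : Fin (n + 2)) : mvfderiv J (fun y => m y (i.removeNth (g · y))) x (v i) = _ :=
    mvfderiv_alternating_apply (g := fun k y => g (i.succAbove k) y) hm
      (fun k => hg (i.succAbove k)) (v i)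
  have h2 := alternating_sum_cancel (m x) (g · x) (fun i l => mvfderiv J (g l) x (v i))
  have h3 (w w' : V) (t : Fin n → V) :
      m x (Fin.cons (w + w') t) = m x (Fin.cons w t) + m x (Fin.cons w' t) :=
    (m x).toAlternatingMap.toMultilinearMap.cons_add t w w'
  simp only [h1, mul_add, add_sub_assoc, h3, Finset.sum_add_distrib, ite_add_zero]
  have h4 : ∑ i : Fin (n + 2), (-1 : ℝ) ^ (i : ℕ) *
      ∑ k, m x (Function.update (fun k => g (i.succAbove k) x) k
        (mvfderiv J (g (i.succAbove k)) x (v i))) = _ := h2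
  rw [h4]
  change (∑ i : Fin (n + 2), (-1 : ℝ) ^ (i : ℕ) *
    (mvfderiv J m x (v i) : V [⋀^Fin (n + 1)]→L[ℝ] ℝ) (i.removeNth (g · x)) + _) + _ = _
  abel

end Alternating

/-! ### Alternating maps on a finite-dimensional space -/

section FiniteDimensional

variable {V : Type*} [NormedAddCommGroup V] [NormedSpace ℝ V] [FiniteDimensional ℝ V]

/-- An alternating map on a finite-dimensional space is continuous. -/
def continuousAlternating {k : ℕ} (m : V [⋀^Fin k]→ₗ[ℝ] ℝ) : V [⋀^Fin k]→L[ℝ] ℝ :=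
  { m with
    cont := by
      let b := Module.finBasis ℝ V
      have h : (fun v => m v) = fun v : Fin k → V =>
          ∑ r : Fin k → Fin (Module.finrank ℝ V), (∏ i, b.coord (r i) (v i)) • m (b ∘ r) := by
        funext v
        have h1 : v = fun i => ∑ q, b.coord q (v i) • b q :=
          funext fun i => (b.sum_repr (v i)).symm
        conv_lhs => rw [h1]
        refine (m.toMultilinearMap.map_sum (fun i q => b.coord q (v i) • b q)).trans ?_
        exact Finset.sum_congr rfl fun r _ => m.toMultilinearMap.map_smul_univ _ _
      have hc (q) : Continuous (b.coord q) := LinearMap.continuous_of_finiteDimensional _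
      change Continuous (fun v => m v)
      rw [h]
      fun_prop }

/-- A family of alternating maps on a finite-dimensional space is differentiable if all its values
on fixed vectors are. -/
theorem mdifferentiableAt_alternating {EN : Type*} [NormedAddCommGroup EN] [NormedSpace ℝ EN]
    {HN : Type*} [TopologicalSpace HN] {J : ModelWithCorners ℝ EN HN}
    {N : Type*} [TopologicalSpace N] [ChartedSpace HN N] {k : ℕ}
    {m : N → V [⋀^Fin k]→L[ℝ] ℝ} {x : N}
    (h : ∀ w : Fin k → V, MDifferentiableAt J 𝓘(ℝ, ℝ) (fun y => m y w) x) :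
    MDifferentiableAt J 𝓘(ℝ, V [⋀^Fin k]→L[ℝ] ℝ) m x := by
  let b := Module.finBasis ℝ V
  let Θ : (V [⋀^Fin k]→L[ℝ] ℝ) →ₗ[ℝ] ((Fin k → Fin (Module.finrank ℝ V)) → ℝ) :=
    { toFun := fun f r => f (b ∘ r)
      map_add' := fun _ _ => rfl
      map_smul' := fun _ _ => rfl }
  have hΘ : LinearMap.ker Θ = ⊥ := by
    refine LinearMap.ker_eq_bot.2 fun f f' hff => ?_
    have : f.toMultilinearMap = f'.toMultilinearMap :=
      Module.Basis.ext_multilinear (fun _ => b) fun r => congrFun hff r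
    ext v
    exact DFunLike.congr_fun this v
  -- the values on basis vectors determine an alternating map, linearly and so differentiably
  obtain ⟨r, hr⟩ := Θ.exists_leftInverse_of_injective hΘ
  have h1 : MDifferentiableAt J 𝓘(ℝ, (Fin k → Fin (Module.finrank ℝ V)) → ℝ)
      (fun y => Θ (m y)) x :=
    (mdifferentiableAt_iff _ _).2 ⟨continuousAt_pi.2 fun s => (h (b ∘ s)).continuousAt,
      differentiableWithinAt_pi.2 fun s => ((mdifferentiableAt_iff _ _).1 (h (b ∘ s))).2⟩
  have h2 : m = fun y => LinearMap.toContinuousLinearMap r (Θ (m y)) :=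
    funext fun y => (LinearMap.congr_fun hr (m y)).symm
  rw [h2]
  exact (LinearMap.toContinuousLinearMap r).differentiableAt.mdifferentiableAt.comp x h1

end FiniteDimensional

/-! ### Coordinates on the prolongation over the projection of a vector bundle -/

section Coordinates

variable {EM : Type*} [NormedAddCommGroup EM] [NormedSpace ℝ EM] [FiniteDimensional ℝ EM]
  {H : Type*} [TopologicalSpace H] {I : ModelWithCorners ℝ EM H}
  {M : Type*} [TopologicalSpace M] [ChartedSpace H M] [IsManifold I ∞ M] [T2Space M]
  {F : Type*} [NormedAddCommGroup F] [NormedSpace ℝ F] [FiniteDimensional ℝ F]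
  {E : M → Type*} [∀ x, AddCommGroup (E x)] [∀ x, Module ℝ (E x)]
  [∀ x, TopologicalSpace (E x)] [TopologicalSpace (TotalSpace F E)]
  [FiberBundle F E] [VectorBundle ℝ F E] [ContMDiffVectorBundle ∞ F E I]
  {F' : Type*} [NormedAddCommGroup F'] [NormedSpace ℝ F'] [FiniteDimensional ℝ F']
  {E' : M → Type*} [∀ x, AddCommGroup (E' x)] [∀ x, Module ℝ (E' x)]
  [∀ x, TopologicalSpace (E' x)] [TopologicalSpace (TotalSpace F' E')]
  [FiberBundle F' E'] [VectorBundle ℝ F' E'] [ContMDiffVectorBundle ∞ F' E' I]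

/-- The fibre coordinate of a point of the total space, in the preferred trivialization at the base
point of `a₀`. -/
def vertCoord (a₀ a : TotalSpace F' E') : F' := fibreCoord F' E' a₀.proj a.proj a.snd

theorem contMDiffAt_vertCoord {a₀ a : TotalSpace F' E'}
    (ha : a.proj ∈ (trivializationAt F' E' a₀.proj).baseSet) :
    ContMDiffAt (I.prod 𝓘(ℝ, F')) 𝓘(ℝ, F') ∞ (vertCoord a₀) a :=
  ((contMDiffAt_along_iff (I := I) (J := I.prod 𝓘(ℝ, F')) (f := fun a : TotalSpace F' E' => a.proj)
    (σ := fun a => a.snd) ha).1 contMDiffAt_id).2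

theorem eventually_proj_mem_baseSet (a₀ : TotalSpace F' E') :
    ∀ᶠ a : TotalSpace F' E' in 𝓝 a₀, a.proj ∈ (trivializationAt F' E' a₀.proj).baseSet :=
  (FiberBundle.continuous_proj F' E').continuousAt.eventually
    (eventually_mem_baseSet F' E' a₀.proj)

variable (I) in
/-- In the preferred trivialization at `a₀` of the tangent bundle of the total space, a tangent
vector splits into the coordinates of its projection to the base and the derivative of the fibre
coordinate. -/
theorem fibreCoord_tangent (a₀ a : TotalSpace F' E')
    (ha : a.proj ∈ (trivializationAt F' E' a₀.proj).baseSet)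
    (ha' : a.proj ∈ (chartAt H a₀.proj).source) (v : TangentSpace (I.prod 𝓘(ℝ, F')) a) :
    fibreCoord (EM × F') (TangentSpace (I.prod 𝓘(ℝ, F')) : TotalSpace F' E' → Type _) a₀ a v =
      (fibreCoord EM (TangentSpace I : M → Type _) a₀.proj a.proj
        (mfderiv (I.prod 𝓘(ℝ, F')) I (TotalSpace.proj : TotalSpace F' E' → M) a v),
      mvfderiv (I.prod 𝓘(ℝ, F')) (vertCoord a₀) a v) := by
  have hs : a ∈ (chartAt (ModelProd H F') a₀).source := by
    rw [FiberBundle.chartedSpace_chartAt]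
    simp [ha, ha', Trivialization.mem_source]
  have hM : IsManifold I 1 M := IsManifold.of_le (n := ∞) (by simp)
  have hM' : IsManifold (I.prod 𝓘(ℝ, F')) 1 (TotalSpace F' E') :=
    IsManifold.of_le (n := ∞) (by simp)
  have h1 : fibreCoord (EM × F') (TangentSpace (I.prod 𝓘(ℝ, F')) : TotalSpace F' E' → Type _)
      a₀ a v = mvfderiv (I.prod 𝓘(ℝ, F')) (extChartAt (I.prod 𝓘(ℝ, F')) a₀) a v :=
    DFunLike.congr_fun (TangentBundle.continuousLinearMapAt_trivializationAt hs) v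
  have h2 : fibreCoord EM (TangentSpace I : M → Type _) a₀.proj a.proj
        (mfderiv (I.prod 𝓘(ℝ, F')) I (TotalSpace.proj : TotalSpace F' E' → M) a v) =
      mvfderiv I (extChartAt I a₀.proj) a.proj
        (mfderiv (I.prod 𝓘(ℝ, F')) I (TotalSpace.proj : TotalSpace F' E' → M) a v) :=
    DFunLike.congr_fun (TangentBundle.continuousLinearMapAt_trivializationAt ha') _
  have hp : MDifferentiableAt (I.prod 𝓘(ℝ, F')) I (TotalSpace.proj : TotalSpace F' E' → M) a :=
    (contMDiff_proj E' (n := ∞)).mdifferentiableAt (by simp)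
  have he : MDifferentiableAt I 𝓘(ℝ, EM) (extChartAt I a₀.proj) a.proj :=
    mdifferentiableAt_extChartAt ha'
  have he' : MDifferentiableAt (I.prod 𝓘(ℝ, F')) 𝓘(ℝ, EM × F')
      (extChartAt (I.prod 𝓘(ℝ, F')) a₀) a := mdifferentiableAt_extChartAt hs
  rw [h1, h2, ← mvfderiv_comp_of_eq_apply he hp rfl]
  have h3 : extChartAt (I.prod 𝓘(ℝ, F')) a₀ =ᶠ[𝓝 a]
      fun z => (extChartAt I a₀.proj z.proj, vertCoord a₀ z) := by
    filter_upwards [(FiberBundle.continuous_proj F' E').continuousAt.preimage_mem_nhds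
      ((trivializationAt F' E' a₀.proj).open_baseSet.mem_nhds ha)] with z hz
    rw [FiberBundle.extChartAt]
    refine Prod.ext ?_ ?_
    · simp [Trivialization.coe_fst' _ hz]
    · exact (fibreCoord_apply hz z.snd).symm
  refine Prod.ext ?_ ?_
  · refine (mvfderiv_clm_comp (ContinuousLinearMap.fst ℝ EM F') he' v).symm.trans ?_
    refine mvfderiv_congr ?_ v
    filter_upwards [h3] with z hz
    rw [hz]
    rfl
  · refine (mvfderiv_clm_comp (ContinuousLinearMap.snd ℝ EM F') he' v).symm.trans ?_
    refine mvfderiv_congr ?_ v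
    filter_upwards [h3] with z hz
    rw [hz]
    rfl

variable (A : LieAlgebroid I F E)

/-- Coordinates on the fibres of the prolongation of `E` over the projection of a vector bundle
`E'`: the coordinates of the first component, and the derivative of the fibre coordinate of `E'`
along the second one. -/
def prolongCoord (a₀ a : TotalSpace F' E') :
    prolongFiber (I.prod 𝓘(ℝ, F')) A (TotalSpace.proj : TotalSpace F' E' → M) a →ₗ[ℝ] F × F' where
  toFun z := (fibreCoord F E a₀.proj a.proj z.1.1,
    mvfderiv (I.prod 𝓘(ℝ, F')) (vertCoord a₀) a z.1.2)
  map_add' z w := Prod.ext ((fibreCoord F E a₀.proj a.proj).map_add z.1.1 w.1.1)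
    ((mvfderiv (I.prod 𝓘(ℝ, F')) (vertCoord a₀) a).map_add z.1.2 w.1.2)
  map_smul' r z := Prod.ext ((fibreCoord F E a₀.proj a.proj).map_smul r z.1.1)
    ((mvfderiv (I.prod 𝓘(ℝ, F')) (vertCoord a₀) a).map_smul r z.1.2)

theorem eventually_injective_prolongCoord (a₀ : TotalSpace F' E') :
    ∀ᶠ a in 𝓝 a₀, Function.Injective (prolongCoord A a₀ a) := by
  filter_upwards [eventually_proj_mem_baseSet a₀,
    (FiberBundle.continuous_proj F' E').continuousAt.preimage_mem_nhds
      (chart_source_mem_nhds H a₀.proj),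
    (FiberBundle.continuous_proj F' E').continuousAt.eventually
      (eventually_mem_baseSet F E a₀.proj)] with a h1 h2 h3 z w hzw
  have h2 : a.proj ∈ (chartAt H a₀.proj).source := h2
  have h4 : z.1.1 = w.1.1 := fibreCoord_injective h3 (congrArg Prod.fst hzw)
  have h5 : mfderiv (I.prod 𝓘(ℝ, F')) I (TotalSpace.proj : TotalSpace F' E' → M) a z.1.2 =
      mfderiv (I.prod 𝓘(ℝ, F')) I (TotalSpace.proj : TotalSpace F' E' → M) a w.1.2 :=
    z.2.symm.trans ((congrArg (A.anchor a.proj) h4).trans w.2)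
  refine Subtype.ext (Prod.ext h4 ?_)
  have hs : a ∈ (trivializationAt (EM × F')
      (TangentSpace (I.prod 𝓘(ℝ, F')) : TotalSpace F' E' → Type _) a₀).baseSet := by
    rw [TangentBundle.trivializationAt_baseSet, FiberBundle.chartedSpace_chartAt]
    simp [h1, h2, Trivialization.mem_source]
  apply fibreCoord_injective hs
  rw [fibreCoord_tangent I a₀ a h1 h2, fibreCoord_tangent I a₀ a h1 h2, h5]
  exact congrArg _ (congrArg Prod.snd hzw)

/-- Near every point, the prolongation over the projection of a vector bundle has global sections
with prescribed constant coordinates. -/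
theorem exists_constProlongSection (a₀ : TotalSpace F' E') :
    ∃ Z : F × F' → ProlongSection (I.prod 𝓘(ℝ, F')) A (TotalSpace.proj : TotalSpace F' E' → M),
      ∀ᶠ a in 𝓝 a₀, ∀ w, prolongCoord A a₀ a ((Z w).eval a) = w := by
  let e := trivializationAt F E a₀.proj
  let TM := trivializationAt EM (TangentSpace I : M → Type _) a₀.proj
  let T := trivializationAt (EM × F')
      (TangentSpace (I.prod 𝓘(ℝ, F')) : TotalSpace F' E' → Type _) a₀
  let U : Set M := e.baseSet ∩ ((chartAt H a₀.proj).source ∩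
    (trivializationAt F' E' a₀.proj).baseSet)
  have hU : IsOpen U := e.open_baseSet.inter
    ((chartAt H a₀.proj).open_source.inter (trivializationAt F' E' a₀.proj).open_baseSet)
  have ha₀ : a₀.proj ∈ U := ⟨FiberBundle.mem_baseSet_trivializationAt' _, mem_chart_source _ _,
    FiberBundle.mem_baseSet_trivializationAt' _⟩
  have hs {a : TotalSpace F' E'} (ha : a.proj ∈ U) : a ∈ T.baseSet := by
    rw [TangentBundle.trivializationAt_baseSet, FiberBundle.chartedSpace_chartAt]
    simp [ha.2.1, ha.2.2, Trivialization.mem_source]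
  obtain ⟨χ, h1, h2⟩ := exists_bump I (hU.mem_nhds ha₀)
  have hπ : ContMDiff (I.prod 𝓘(ℝ, F')) I ∞ (TotalSpace.proj : TotalSpace F' E' → M) :=
    contMDiff_proj E'
  have hχ : ContMDiff (I.prod 𝓘(ℝ, F')) 𝓘(ℝ, ℝ) ∞ (fun a : TotalSpace F' E' => χ a.proj) :=
    χ.contMDiff.comp hπ
  have hsupp {a : TotalSpace F' E'} (ha : a ∈ tsupport fun a : TotalSpace F' E' => χ a.proj) :
      a.proj ∈ U :=
    h2 (closure_minimal (s := Function.support fun a : TotalSpace F' E' => χ a.proj)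
      (t := TotalSpace.proj ⁻¹' tsupport χ) (fun z hz => subset_tsupport χ hz)
      ((isClosed_tsupport χ).preimage hπ.continuous) ha)
  -- the second component lies over `ρ(s₁)` and differentiates the fibre coordinate to `w.2`
  let s₁ (w : F × F') (a : TotalSpace F' E') : E a.proj := e.symmL ℝ a.proj w.1
  let s₂ (w : F × F') (a : TotalSpace F' E') : TangentSpace (I.prod 𝓘(ℝ, F')) a :=
    T.symmL ℝ a (fibreCoord EM (TangentSpace I : M → Type _) a₀.proj a.proj
      (A.anchor a.proj (s₁ w a)), w.2)
  have hs₁ (w : F × F') {a : TotalSpace F' E'} (ha : a.proj ∈ U) :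
      ContMDiffAt (I.prod 𝓘(ℝ, F')) (I.prod 𝓘(ℝ, F)) ∞
        (fun a => (⟨a.proj, s₁ w a⟩ : TotalSpace F E)) a := by
    refine (contMDiffAt_along_iff ha.1).2 ⟨hπ a, ?_⟩
    refine (contMDiffAt_const (c := w.1)).congr_of_eventuallyEq ?_
    filter_upwards [hπ.continuous.continuousAt.preimage_mem_nhds (hU.mem_nhds ha)] with z hz
    exact e.continuousLinearMapAt_symmL hz.1 w.1
  have hs₂ (w : F × F') {a : TotalSpace F' E'} (ha : a.proj ∈ U) :
      ContMDiffAt (I.prod 𝓘(ℝ, F')) (I.prod 𝓘(ℝ, F')).tangent ∞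
        (fun a => (⟨a, s₂ w a⟩ : TangentBundle (I.prod 𝓘(ℝ, F')) (TotalSpace F' E'))) a := by
    refine (contMDiffAt_along_iff (f := fun a => a) (hs ha)).2 ⟨contMDiffAt_id, ?_⟩
    have hTM : a.proj ∈ TM.baseSet := by
      rw [TangentBundle.trivializationAt_baseSet]
      exact ha.2.1
    have h3 : ContMDiffAt (I.prod 𝓘(ℝ, F')) I.tangent ∞
        (fun a => (⟨a.proj, A.anchor a.proj (s₁ w a)⟩ : TangentBundle I M)) a :=
      (A.contMDiff_anchor _).comp a (hs₁ w ha)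
    have h4 := ((contMDiffAt_along_iff (E := (TangentSpace I : M → Type _)) hTM).1 h3).2
    refine (h4.prodMk_space (contMDiffAt_const (c := w.2))).congr_of_eventuallyEq ?_
    filter_upwards [hπ.continuous.continuousAt.preimage_mem_nhds (hU.mem_nhds ha)] with z hz
    exact T.continuousLinearMapAt_symmL (hs hz) _
  have hcoord (w : F × F') {a : TotalSpace F' E'} (ha : a.proj ∈ U) :
      A.anchor a.proj (s₁ w a) =
        mfderiv (I.prod 𝓘(ℝ, F')) I (TotalSpace.proj : TotalSpace F' E' → M) a (s₂ w a) ∧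
      mvfderiv (I.prod 𝓘(ℝ, F')) (vertCoord a₀) a (s₂ w a) = w.2 := by
    have h3 := fibreCoord_tangent I a₀ a ha.2.2 ha.2.1 (s₂ w a)
    have h4 : fibreCoord (EM × F')
        (TangentSpace (I.prod 𝓘(ℝ, F')) : TotalSpace F' E' → Type _) a₀ a (s₂ w a) = _ :=
      T.continuousLinearMapAt_symmL (hs ha) _
    rw [h4] at h3
    have hTM : a.proj ∈ TM.baseSet := by
      rw [TangentBundle.trivializationAt_baseSet]
      exact ha.2.1
    exact ⟨fibreCoord_injective hTM (congrArg Prod.fst h3), (congrArg Prod.snd h3).symm⟩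
  refine ⟨fun w =>
    { fst := fun a => χ a.proj • s₁ w a
      snd := fun a => χ a.proj • s₂ w a
      contMDiff_fst := contMDiff_along_cutoff hπ hχ fun a ha => hs₁ w (hsupp ha)
      contMDiff_snd := contMDiff_along_cutoff (f := fun a => a) contMDiff_id hχ
        fun a ha => hs₂ w (hsupp ha)
      compat := fun a => ?_ }, ?_⟩
  · rw [map_smul, map_smul]
    by_cases ha : a.proj ∈ U
    · rw [(hcoord w ha).1]
    · have hz : χ a.proj = 0 := image_eq_zero_of_notMem_tsupport fun h => ha (h2 h)
      rw [hz, zero_smul, zero_smul]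
  · filter_upwards [hπ.continuous.continuousAt.eventually h1,
      hπ.continuous.continuousAt.eventually (hU.mem_nhds ha₀)] with a h3 h4 w
    refine Prod.ext ?_ ?_
    · change fibreCoord F E a₀.proj a.proj (χ a.proj • s₁ w a) = w.1
      rw [h3, one_smul]
      exact e.continuousLinearMapAt_symmL h4.1 w.1
    · change mvfderiv (I.prod 𝓘(ℝ, F')) (vertCoord a₀) a (χ a.proj • s₂ w a) = w.2
      rw [h3, one_smul]
      exact (hcoord w h4).2

/-- Every element of a fibre is the value of a section. -/
theorem exists_eval_eq (a : TotalSpace F' E')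
    (z : prolongFiber (I.prod 𝓘(ℝ, F')) A (TotalSpace.proj : TotalSpace F' E' → M) a) :
    ∃ X : ProlongSection (I.prod 𝓘(ℝ, F')) A (TotalSpace.proj : TotalSpace F' E' → M),
      X.eval a = z := by
  obtain ⟨Z, hZ⟩ := exists_constProlongSection A a
  exact ⟨Z (prolongCoord A a a z),
    (eventually_injective_prolongCoord A a).self_of_nhds (hZ.self_of_nhds _)⟩

end Coordinates

/-! ### Brackets along a smooth map into the total space -/

section Induced

variable {EM : Type*} [NormedAddCommGroup EM] [NormedSpace ℝ EM] [FiniteDimensional ℝ EM]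
  {H : Type*} [TopologicalSpace H] {I : ModelWithCorners ℝ EM H}
  {M : Type*} [TopologicalSpace M] [ChartedSpace H M] [IsManifold I ∞ M] [T2Space M]
  {F : Type*} [NormedAddCommGroup F] [NormedSpace ℝ F] [FiniteDimensional ℝ F]
  {E : M → Type*} [∀ x, AddCommGroup (E x)] [∀ x, Module ℝ (E x)]
  [∀ x, TopologicalSpace (E x)] [TopologicalSpace (TotalSpace F E)]
  [FiberBundle F E] [VectorBundle ℝ F E] [ContMDiffVectorBundle ∞ F E I]
  {F' : Type*} [NormedAddCommGroup F'] [NormedSpace ℝ F'] [FiniteDimensional ℝ F']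
  {E' : M → Type*} [∀ x, AddCommGroup (E' x)] [∀ x, Module ℝ (E' x)]
  [∀ x, TopologicalSpace (E' x)] [TopologicalSpace (TotalSpace F' E')]
  [FiberBundle F' E'] [VectorBundle ℝ F' E'] [ContMDiffVectorBundle ∞ F' E' I]
  {EN : Type*} [NormedAddCommGroup EN] [NormedSpace ℝ EN] [CompleteSpace EN]
  {HN : Type*} [TopologicalSpace HN] {J : ModelWithCorners ℝ EN HN} [J.Boundaryless]
  {N : Type*} [TopologicalSpace N] [ChartedSpace HN N] [IsManifold J ∞ N]
  (A : LieAlgebroid I F E) {φ : N → TotalSpace F' E'}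
  (hφ : ContMDiff J (I.prod 𝓘(ℝ, F')) ∞ φ)

/-- The map `(b, v) ↦ (b, Tφ(v))` between prolongations induced by a smooth map `φ` into the total
space of `E'`. The prolongation on the source is taken over the composition of `φ` with the
projection. -/
def prolongMap (x : N) : prolongFiber J A (fun y => (φ y).proj) x →ₗ[ℝ]
    prolongFiber (I.prod 𝓘(ℝ, F')) A (TotalSpace.proj : TotalSpace F' E' → M) (φ x) where
  toFun z := ⟨(z.1.1, mfderiv J (I.prod 𝓘(ℝ, F')) φ x z.1.2), by
    have hp : MDifferentiableAt (I.prod 𝓘(ℝ, F')) I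
        (TotalSpace.proj : TotalSpace F' E' → M) (φ x) :=
      (contMDiff_proj E' (n := ∞)).mdifferentiableAt (by simp)
    have h := mfderiv_comp x hp (hφ.mdifferentiableAt (by simp))
    exact Eq.trans z.2 (DFunLike.congr_fun h z.1.2)⟩
  map_add' z w := Subtype.ext (Prod.ext rfl ((mfderiv J (I.prod 𝓘(ℝ, F')) φ x).map_add z.1.2 w.1.2))
  map_smul' r z := Subtype.ext (Prod.ext rfl ((mfderiv J (I.prod 𝓘(ℝ, F')) φ x).map_smul r z.1.2))

variable (a₀ : TotalSpace F' E') (X Y : ProlongSection J A (fun y => (φ y).proj))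

/-- The coordinates of the image of a section under the map induced by `φ`. -/
def pushCoord (y : N) : F × F' := prolongCoord A a₀ (φ y) (prolongMap A hφ y (X.eval y))

variable {a₀}

theorem pushCoord_eq {y : N} (hy : (φ y).proj ∈ (trivializationAt F' E' a₀.proj).baseSet) :
    pushCoord A hφ a₀ X y = (fibreCoord F E a₀.proj (φ y).proj (X.fst y),
      mvfderiv J (fun z => vertCoord a₀ (φ z)) y (X.snd y)) := by
  refine Prod.ext rfl ?_
  exact (mvfderiv_comp_of_eq_apply ((contMDiffAt_vertCoord (I := I) hy).mdifferentiableAt (by simp))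
    (hφ.mdifferentiableAt (by simp)) rfl (X.snd y)).symm

variable {x : N}

theorem eventually_pushCoord_eq (hx : φ x = a₀) : ∀ᶠ y in 𝓝 x, pushCoord A hφ a₀ X y =
    (fibreCoord F E a₀.proj (φ y).proj (X.fst y),
      mvfderiv J (fun z => vertCoord a₀ (φ z)) y (X.snd y)) := by
  subst hx
  filter_upwards [hφ.continuous.continuousAt.eventually
    (eventually_proj_mem_baseSet (φ x))] with y hy
  exact pushCoord_eq A hφ X hy

theorem contMDiffAt_vertCoord_comp (hφ : ContMDiff J (I.prod 𝓘(ℝ, F')) ∞ φ) (x : N) :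
    ContMDiffAt J 𝓘(ℝ, F') ∞ (fun z => vertCoord (φ x) (φ z)) x :=
  (contMDiffAt_vertCoord (I := I) (FiberBundle.mem_baseSet_trivializationAt' _)).comp x (hφ x)

theorem contMDiff_proj_comp (hφ : ContMDiff J (I.prod 𝓘(ℝ, F')) ∞ φ) :
    ContMDiff J I ∞ (fun y => (φ y).proj) :=
  (contMDiff_proj E').comp hφ

theorem mdifferentiableAt_pushCoord_fst (x : N) : MDifferentiableAt J 𝓘(ℝ, F)
    (fun y => fibreCoord F E (φ x).proj (φ y).proj (X.fst y)) x :=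
  (X.contMDiffAt_fibreCoord (x := x)
    (FiberBundle.mem_baseSet_trivializationAt' _)).mdifferentiableAt (by simp)

theorem mdifferentiableAt_pushCoord_snd (hφ : ContMDiff J (I.prod 𝓘(ℝ, F')) ∞ φ)
    (X : ProlongSection J A (fun y => (φ y).proj)) (x : N) : MDifferentiableAt J 𝓘(ℝ, F')
    (fun y => mvfderiv J (fun z => vertCoord (φ x) (φ z)) y (X.snd y)) x :=
  (contMDiffAt_mvfderiv_apply (contMDiffAt_vertCoord_comp hφ x)
    (X.contMDiff_snd x)).mdifferentiableAt (by simp)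

theorem mdifferentiableAt_pushCoord (x : N) :
    MDifferentiableAt J 𝓘(ℝ, F × F') (pushCoord A hφ (φ x) X) x :=
  ((mdifferentiableAt_pushCoord_fst A X x).prodMk_space
    (mdifferentiableAt_pushCoord_snd A hφ X x)).congr_of_eventuallyEq
    (eventually_pushCoord_eq A hφ X rfl)

theorem mvfderiv_pushCoord (x : N) (v : TangentSpace J x) :
    mvfderiv J (pushCoord A hφ (φ x) X) x v =
      (mvfderiv J (fun y => fibreCoord F E (φ x).proj (φ y).proj (X.fst y)) x v,
      mvfderiv J (fun y => mvfderiv J (fun z => vertCoord (φ x) (φ z)) y (X.snd y)) x v) := by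
  have h := mdifferentiableAt_pushCoord A hφ X x
  refine Prod.ext ?_ ?_
  · refine (mvfderiv_clm_comp (ContinuousLinearMap.fst ℝ F F') h v).symm.trans (mvfderiv_congr ?_ v)
    filter_upwards [eventually_pushCoord_eq A hφ X rfl] with y hy
    rw [hy]
    rfl
  · refine (mvfderiv_clm_comp (ContinuousLinearMap.snd ℝ F F') h v).symm.trans (mvfderiv_congr ?_ v)
    filter_upwards [eventually_pushCoord_eq A hφ X rfl] with y hy
    rw [hy]
    rfl

/-- The bracket of two sections in the coordinates of the target: besides the derivatives of the
coordinates it involves only the coordinates at the point. -/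
theorem pushCoord_prolongBracket (x : N) :
    pushCoord A hφ (φ x) (prolongBracket X Y) x =
      (A.localBracket (φ x).proj (pushCoord A hφ (φ x) X x).1 (pushCoord A hφ (φ x) Y x).1, 0) +
      mvfderiv J (pushCoord A hφ (φ x) Y) x (X.snd x) -
      mvfderiv J (pushCoord A hφ (φ x) X) x (Y.snd x) := by
  have hf := contMDiff_proj_comp hφ
  have h1 : pushCoord A hφ (φ x) (prolongBracket X Y) x = _ :=
    (eventually_pushCoord_eq A hφ (prolongBracket X Y) rfl).self_of_nhds
  have hfst := (congrArg (fibreCoord F E (φ x).proj (φ x).proj) (prolongBracket_fst hf X Y x)).trans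
    (fibreCoord_bracketFst X Y x)
  have hsnd : mvfderiv J (fun z => vertCoord (φ x) (φ z)) x ((prolongBracket X Y).snd x) = _ :=
    (congrArg _ (prolongBracket_snd hf X Y x)).trans
      (mvfderiv_mlieBracket (X.contMDiff_snd x) (Y.contMDiff_snd x)
        (contMDiffAt_vertCoord_comp hφ x))
  rw [h1, mvfderiv_pushCoord, mvfderiv_pushCoord]
  refine Prod.ext ?_ ?_
  · exact hfst
  · refine hsnd.trans ?_
    change _ = (0 : F') + _ - _
    rw [zero_add]

end Induced

/-! ### Naturality of the differential -/

section Differential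

variable {EM : Type*} [NormedAddCommGroup EM] [NormedSpace ℝ EM] [FiniteDimensional ℝ EM]
  {H : Type*} [TopologicalSpace H] {I : ModelWithCorners ℝ EM H}
  {M : Type*} [TopologicalSpace M] [ChartedSpace H M] [IsManifold I ∞ M] [T2Space M]
  {F : Type*} [NormedAddCommGroup F] [NormedSpace ℝ F] [FiniteDimensional ℝ F]
  {E : M → Type*} [∀ x, AddCommGroup (E x)] [∀ x, Module ℝ (E x)]
  [∀ x, TopologicalSpace (E x)] [TopologicalSpace (TotalSpace F E)]
  [FiberBundle F E] [VectorBundle ℝ F E] [ContMDiffVectorBundle ∞ F E I]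
  {F' : Type*} [NormedAddCommGroup F'] [NormedSpace ℝ F'] [FiniteDimensional ℝ F']
  {E' : M → Type*} [∀ x, AddCommGroup (E' x)] [∀ x, Module ℝ (E' x)]
  [∀ x, TopologicalSpace (E' x)] [TopologicalSpace (TotalSpace F' E')]
  [FiberBundle F' E'] [VectorBundle ℝ F' E'] [ContMDiffVectorBundle ∞ F' E' I]
  {EN : Type*} [NormedAddCommGroup EN] [NormedSpace ℝ EN] [CompleteSpace EN]
  {HN : Type*} [TopologicalSpace HN] {J : ModelWithCorners ℝ EN HN} [J.Boundaryless]
  {N : Type*} [TopologicalSpace N] [ChartedSpace HN N] [IsManifold J ∞ N]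
  (A : LieAlgebroid I F E) {φ : N → TotalSpace F' E'}
  (hφ : ContMDiff J (I.prod 𝓘(ℝ, F')) ∞ φ)


/-- A form on the prolongation, in coordinates near a point: a differentiable family of alternating
maps on the model fibre. -/
theorem exists_localForm {k : ℕ}
    {μ : Cochain (I.prod 𝓘(ℝ, F')) A (TotalSpace.proj : TotalSpace F' E' → M) k} (hμ : IsForm μ)
    (a₀ : TotalSpace F' E') :
    ∃ m : TotalSpace F' E' → (F × F') [⋀^Fin k]→L[ℝ] ℝ,
      MDifferentiableAt (I.prod 𝓘(ℝ, F')) 𝓘(ℝ, (F × F') [⋀^Fin k]→L[ℝ] ℝ) m a₀ ∧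
      ∀ᶠ a in 𝓝 a₀, ∀ z, μ a z = m a (fun i => prolongCoord A a₀ a (z i)) := by
  obtain ⟨Z, hZ⟩ := exists_constProlongSection A a₀
  have hinj := eventually_injective_prolongCoord A a₀
  choose alt halt using hμ.1
  have hs (a : TotalSpace F' E') : ∃ s : F × F' →ₗ[ℝ]
      prolongFiber (I.prod 𝓘(ℝ, F')) A (TotalSpace.proj : TotalSpace F' E' → M) a,
      Function.Bijective (prolongCoord A a₀ a) → ∀ z, s (prolongCoord A a₀ a z) = z := by
    by_cases h : Function.Bijective (prolongCoord A a₀ a)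
    · exact ⟨(LinearEquiv.ofBijective _ h).symm, fun _ z =>
        (LinearEquiv.ofBijective _ h).symm_apply_apply z⟩
    · exact ⟨0, fun h' => absurd h' h⟩
  -- `s a` is the inverse of the coordinate map where this map is bijective
  choose s hs using hs
  have hbij : ∀ᶠ a in 𝓝 a₀, Function.Bijective (prolongCoord A a₀ a) := by
    filter_upwards [hinj, hZ] with a h1 h2
    exact ⟨h1, fun w => ⟨_, h2 w⟩⟩
  have hm (a : TotalSpace F' E') (w : Fin k → F × F') :
      continuousAlternating ((alt a).compLinearMap (s a)) w = μ a (fun i => s a (w i)) :=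
    (halt a _).symm
  refine ⟨fun a => continuousAlternating ((alt a).compLinearMap (s a)), ?_, ?_⟩
  · refine mdifferentiableAt_alternating fun w => ?_
    refine ((hμ.2 fun i => Z (w i)).mdifferentiableAt (by simp)).congr_of_eventuallyEq ?_
    filter_upwards [hbij, hZ] with a h1 h2
    rw [hm]
    congr 1
    funext i
    refine Eq.trans ?_ (hs a h1 ((Z (w i)).eval a))
    rw [h2]
  · filter_upwards [hbij] with a h1 z
    rw [hm]
    simp only [hs a h1]

/-- The value of the differential in coordinates: the right-hand side of the formula for the
differential, for arguments that have constant coordinates. -/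
def koszulCoord {k : ℕ} (m : TotalSpace F' E' → (F × F') [⋀^Fin (k + 1)]→L[ℝ] ℝ)
    (a : TotalSpace F' E') (z : Fin (k + 2) →
      prolongFiber (I.prod 𝓘(ℝ, F')) A (TotalSpace.proj : TotalSpace F' E' → M) a) : ℝ :=
  ∑ i : Fin (k + 2), (-1 : ℝ) ^ (i : ℕ) *
      (mvfderiv (I.prod 𝓘(ℝ, F')) m a (z i).1.2 : (F × F') [⋀^Fin (k + 1)]→L[ℝ] ℝ)
        (i.removeNth fun l => prolongCoord A a a (z l)) +
    ∑ i : Fin (k + 1), ∑ j : Fin (k + 1), (if i ≤ j then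
      (-1 : ℝ) ^ ((i : ℕ) + ((j : ℕ) + 1)) *
        m a (Fin.cons (A.localBracket a.proj (prolongCoord A a a (z i.castSucc)).1
            (prolongCoord A a a (z j.succ)).1, 0)
          (j.removeNth (i.castSucc.removeNth fun l => prolongCoord A a a (z l))))
      else 0)

/-- The formula for the differential of a pull-back depends on the sections only through the images
of their values at the point. -/
theorem koszul_pullback_eq_koszulCoord {k : ℕ}
    {μ : Cochain (I.prod 𝓘(ℝ, F')) A (TotalSpace.proj : TotalSpace F' E' → M) (k + 1)}
    {m : TotalSpace F' E' → (F × F') [⋀^Fin (k + 1)]→L[ℝ] ℝ} {x : N}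
    (hm : MDifferentiableAt (I.prod 𝓘(ℝ, F')) 𝓘(ℝ, (F × F') [⋀^Fin (k + 1)]→L[ℝ] ℝ) m (φ x))
    (h : ∀ᶠ a in 𝓝 (φ x), ∀ z, μ a z = m a (fun i => prolongCoord A (φ x) a (z i)))
    (X : Fin (k + 2) → ProlongSection J A (fun y => (φ y).proj)) :
    koszul (pullback φ (prolongMap A hφ) μ) X x =
      koszulCoord A m (φ x) (fun i => prolongMap A hφ x ((X i).eval x)) := by
  have hφx : MDifferentiableAt J (I.prod 𝓘(ℝ, F')) φ x := hφ.mdifferentiableAt (by simp)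
  let g : Fin (k + 2) → N → F × F' := fun i => pushCoord A hφ (φ x) (X i)
  have hg (i) : MDifferentiableAt J 𝓘(ℝ, F × F') (g i) x := mdifferentiableAt_pushCoord A hφ (X i) x
  have h1 (i : Fin (k + 2)) :
      dirDeriv J (fun y => pullback φ (prolongMap A hφ) μ y
        (fun l => (i.removeNth X l).eval y)) x ((X i).snd x) =
      mvfderiv J (fun y => m (φ y) (i.removeNth (g · y))) x ((X i).snd x) := by
    refine mvfderiv_congr ?_ _
    filter_upwards [hφ.continuous.continuousAt.eventually h] with y hy
    exact hy _
  have h2 (i j : Fin (k + 1)) :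
      pullback φ (prolongMap A hφ) μ x (fun l => (Fin.cons
        (prolongBracket (X i.castSucc) (X j.succ)) (j.removeNth (i.castSucc.removeNth X)) :
          Fin (k + 1) → ProlongSection J A (fun y => (φ y).proj)) l |>.eval x) =
      m (φ x) (Fin.cons
        ((A.localBracket (φ x).proj (g i.castSucc x).1 (g j.succ x).1, 0) +
          mvfderiv J (g j.succ) x ((X i.castSucc).snd x) -
          mvfderiv J (g i.castSucc) x ((X j.succ).snd x))
        (j.removeNth (i.castSucc.removeNth (g · x)))) := by
    refine (h.self_of_nhds _).trans (congrArg _ (funext fun l => ?_))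
    refine Fin.cases ?_ (fun l => ?_) l
    · exact pushCoord_prolongBracket A hφ (X i.castSucc) (X j.succ) x
    · rfl
  have h3 := sum_mvfderiv_alternating (m := fun y => m (φ y)) (hm.comp x hφx) hg
    (fun i => (X i).snd x)
    (fun i j => (A.localBracket (φ x).proj (g i x).1 (g j x).1, 0))
  rw [koszul]
  simp only [h1, h2]
  refine h3.trans ?_
  have h4 (i : Fin (k + 2)) : mvfderiv J (fun y => m (φ y)) x ((X i).snd x) = _ :=
    mvfderiv_comp_of_eq_apply hm hφx rfl ((X i).snd x)
  simp only [h4]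
  rfl

theorem pullback_id {k : ℕ}
    (μ : Cochain (I.prod 𝓘(ℝ, F')) A (TotalSpace.proj : TotalSpace F' E' → M) k) :
    pullback (fun a => a) (prolongMap A (φ := fun a : TotalSpace F' E' => a) contMDiff_id) μ =
      μ := by
  funext a z
  refine congrArg (μ a) (funext fun i => Subtype.ext (Prod.ext rfl ?_))
  exact DFunLike.congr_fun (mfderiv_id (I := I.prod 𝓘(ℝ, F')) (x := a)) (z i).1.2

variable [I.Boundaryless]

/-- The right-hand side of the formula for the differential is natural: it takes the same value for
a form and sections on the total space of `E'`, and for the pull-back of the form and sections that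
are mapped to the given ones at one point. -/
theorem koszul_pullback {k : ℕ}
    {μ : Cochain (I.prod 𝓘(ℝ, F')) A (TotalSpace.proj : TotalSpace F' E' → M) k} (hμ : IsForm μ)
    {X : Fin (k + 1) → ProlongSection J A (fun y => (φ y).proj)}
    {Y : Fin (k + 1) →
      ProlongSection (I.prod 𝓘(ℝ, F')) A (TotalSpace.proj : TotalSpace F' E' → M)} {x : N}
    (hXY : ∀ i, prolongMap A hφ x ((X i).eval x) = (Y i).eval (φ x)) :
    koszul (pullback φ (prolongMap A hφ) μ) X x = koszul μ Y (φ x) := by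
  cases k with
  | zero =>
    have hd : MDifferentiableAt (I.prod 𝓘(ℝ, F')) 𝓘(ℝ, ℝ) (fun a => μ a Fin.elim0) (φ x) := by
      refine ((hμ.2 Fin.elim0).mdifferentiableAt (by simp)).congr_of_eventuallyEq
        (Filter.Eventually.of_forall fun a => congrArg (μ a) (funext fun i => i.elim0))
    have h1 : (fun y => pullback φ (prolongMap A hφ) μ y Fin.elim0) =
        fun y => μ (φ y) Fin.elim0 :=
      funext fun y => congrArg (μ (φ y)) (funext fun i => i.elim0)
    rw [koszul, koszul, h1, dirDeriv_eq_mvfderiv, dirDeriv_eq_mvfderiv]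
    refine (mvfderiv_comp_of_eq_apply hd (hφ.mdifferentiableAt (by simp)) rfl _).trans ?_
    exact congrArg _ (congrArg (fun z => z.1.2) (hXY 0))
  | succ k =>
    obtain ⟨m, hm, h⟩ := exists_localForm A hμ (φ x)
    have h2 := koszul_pullback_eq_koszulCoord (J := I.prod 𝓘(ℝ, F')) A
      (φ := fun a : TotalSpace F' E' => a) contMDiff_id hm h Y
    rw [pullback_id] at h2
    rw [koszul_pullback_eq_koszulCoord A hφ hm h X]
    refine Eq.trans ?_ h2.symm
    congr 1
    funext i
    rw [hXY]
    refine Subtype.ext (Prod.ext rfl ?_)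
    exact (DFunLike.congr_fun (mfderiv_id (I := I.prod 𝓘(ℝ, F')) (x := φ x)) ((Y i).snd (φ x))).symm

/-- The differential of a form has the values prescribed by its defining formula. -/
theorem differential_eval {k : ℕ}
    {μ : Cochain (I.prod 𝓘(ℝ, F')) A (TotalSpace.proj : TotalSpace F' E' → M) k} (hμ : IsForm μ)
    (Y : Fin (k + 1) → ProlongSection (I.prod 𝓘(ℝ, F')) A (TotalSpace.proj : TotalSpace F' E' → M))
    (a : TotalSpace F' E') :
    differential μ a (fun i => (Y i).eval a) = koszul μ Y a := by
  choose Z hZ using fun a => exists_eval_eq A (E' := E') (F' := F') a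
  have hex : ∃ ν : Cochain (I.prod 𝓘(ℝ, F')) A (TotalSpace.proj : TotalSpace F' E' → M) (k + 1),
      ∀ (X : Fin (k + 1) →
        ProlongSection (I.prod 𝓘(ℝ, F')) A (TotalSpace.proj : TotalSpace F' E' → M)) (a),
        ν a (fun i => (X i).eval a) = koszul μ X a := by
    refine ⟨fun a z => koszul μ (fun i => Z a (z i)) a, fun X a => ?_⟩
    have h := koszul_pullback (J := I.prod 𝓘(ℝ, F')) A (φ := fun a : TotalSpace F' E' => a)
      contMDiff_id hμ (x := a) (X := X) (Y := fun i => Z a ((X i).eval a)) (fun i => by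
        rw [hZ]
        refine Subtype.ext (Prod.ext rfl ?_)
        exact DFunLike.congr_fun (mfderiv_id (I := I.prod 𝓘(ℝ, F')) (x := a)) ((X i).snd a))
    rw [pullback_id] at h
    exact h.symm
  exact Classical.epsilon_spec hex Y a

/-- The differential commutes with the pull-back along the map of prolongations induced by a smooth
map into the total space of `E'`. The hypothesis `hsec` is needed because `differential` is
determined only on values of sections. -/
theorem differential_pullback_prolongMap {k : ℕ}
    {μ : Cochain (I.prod 𝓘(ℝ, F')) A (TotalSpace.proj : TotalSpace F' E' → M) k} (hμ : IsForm μ)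
    (hsec : ∀ (x : N) (z : prolongFiber J A (fun y => (φ y).proj) x),
      ∃ X : ProlongSection J A (fun y => (φ y).proj), X.eval x = z) :
    differential (pullback φ (prolongMap A hφ) μ) =
      pullback φ (prolongMap A hφ) (differential μ) := by
  have hspec (X : Fin (k + 1) → ProlongSection J A (fun y => (φ y).proj)) (x : N) :
      pullback φ (prolongMap A hφ) (differential μ) x (fun i => (X i).eval x) =
        koszul (pullback φ (prolongMap A hφ) μ) X x := by
    choose Y hY using fun i => exists_eval_eq A (φ x) (prolongMap A hφ x ((X i).eval x))
    rw [koszul_pullback A hφ hμ fun i => (hY i).symm, ← differential_eval A hμ]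
    exact congrArg (differential μ (φ x)) (funext fun i => (hY i).symm)
  -- the pull-back of `dμ` shows that a cochain with the defining property of `d(Φ^* μ)` exists
  have hdiff (X : Fin (k + 1) → ProlongSection J A (fun y => (φ y).proj)) (x : N) :
      differential (pullback φ (prolongMap A hφ) μ) x (fun i => (X i).eval x) =
        koszul (pullback φ (prolongMap A hφ) μ) X x :=
    Classical.epsilon_spec (p := fun ν : Cochain J A (fun y => (φ y).proj) (k + 1) =>
      ∀ (X : Fin (k + 1) → ProlongSection J A (fun y => (φ y).proj)) (x : N),
        ν x (fun i => (X i).eval x) = koszul (pullback φ (prolongMap A hφ) μ) X x)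
      ⟨_, hspec⟩ X x
  funext x z
  choose X hX using fun i => hsec x (z i)
  have hz : z = fun i => (X i).eval x := funext fun i => (hX i).symm
  rw [hz, hdiff, hspec]

end Differential

/-! ### The Legendre transformation -/

section Legendre

variable {EM : Type*} [NormedAddCommGroup EM] [NormedSpace ℝ EM]
  {H : Type*} [TopologicalSpace H] {I : ModelWithCorners ℝ EM H}
  {M : Type*} [TopologicalSpace M] [ChartedSpace H M] [IsManifold I ∞ M]
  {F : Type*} [NormedAddCommGroup F] [NormedSpace ℝ F]
  {E : M → Type*} [∀ x, AddCommGroup (E x)] [∀ x, Module ℝ (E x)]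
  [∀ x, TopologicalSpace (E x)] [TopologicalSpace (TotalSpace F E)]
  [FiberBundle F E] [VectorBundle ℝ F E] [ContMDiffVectorBundle ∞ F E I]
  (A : LieAlgebroid I F E)

/-- The Liouville section is a smooth section of the dual of the prolongation. -/
theorem isForm_liouville : IsForm (liouville A) := by
  refine ⟨fun p => ?_, fun X => ?_⟩
  · let ℓ : prolongFiber (I.prod 𝓘(ℝ, F →L[ℝ] ℝ)) A (tauDual F E) p →ₗ[ℝ] ℝ :=
      (p.snd : E p.proj →ₗ[ℝ] ℝ).comp
        ((LinearMap.fst ℝ (E p.proj) (TangentSpace (I.prod 𝓘(ℝ, F →L[ℝ] ℝ)) p)).comp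
          (Submodule.subtype _))
    exact ⟨AlternatingMap.ofSubsingleton ℝ _ ℝ (0 : Fin 1) ℓ, fun a => rfl⟩
  · intro p
    have h1 : ContMDiffAt (I.prod 𝓘(ℝ, F →L[ℝ] ℝ)) (I.prod 𝓘(ℝ, F →L[ℝ] ℝ)) ∞
        (fun q : DualTotal F E => TotalSpace.mk' (F →L[ℝ] ℝ)
          (E := fun x : M => (E x →L[ℝ] Bundle.Trivial M ℝ x)) q.proj q.snd) p := contMDiffAt_id
    have h2 := ContMDiffAt.clm_bundle_apply (F₁ := F) (E₁ := E) (F₂ := ℝ)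
      (E₂ := Bundle.Trivial M ℝ) h1 ((X 0).contMDiff_fst p)
    have h3 := (contMDiffAt_totalSpace.1 h2).2
    exact h3

end Legendre

end LieAlgd

end

theorem theorem3p2
    {EM : Type*} [NormedAddCommGroup EM] [NormedSpace ℝ EM] [FiniteDimensional ℝ EM]
    {H : Type*} [TopologicalSpace H] (I : ModelWithCorners ℝ EM H) [I.Boundaryless]
    {M : Type*} [TopologicalSpace M] [ChartedSpace H M] [IsManifold I ∞ M]
    [T2Space M] [ParacompactSpace M]
    {F : Type*} [NormedAddCommGroup F] [NormedSpace ℝ F] [FiniteDimensional ℝ F]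
    {E : M → Type*} [∀ x, AddCommGroup (E x)] [∀ x, Module ℝ (E x)]
    [∀ x, TopologicalSpace (E x)] [TopologicalSpace (TotalSpace F E)]
    [FiberBundle F E] [VectorBundle ℝ F E] [ContMDiffVectorBundle ∞ F E I]
    (A : LieAlgd.LieAlgebroid I F E)
    (L : TotalSpace F E → ℝ) (hL : ContMDiff (I.prod 𝓘(ℝ, F)) 𝓘(ℝ, ℝ) ∞ L) :
    LieAlgd.IsLieAlgebroidMorphism (LieAlgd.legendre I L) (LieAlgd.prolongLegendre A hL) ∧
    LieAlgd.pullback (LieAlgd.legendre I L) (LieAlgd.prolongLegendre A hL) (LieAlgd.liouville A) =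
      LieAlgd.poincareCartan A L ∧
    LieAlgd.pullback (LieAlgd.legendre I L) (LieAlgd.prolongLegendre A hL)
        (LieAlgd.canonicalSymplectic A) =
      LieAlgd.poincareCartanTwo A L := by
  have hLeg := LieAlgd.contMDiff_legendre hL
  -- `𝓛Leg_L` is by definition the map of prolongations induced by `Leg_L`
  have hd {k : ℕ} {μ : LieAlgd.Cochain (I.prod 𝓘(ℝ, F →L[ℝ] ℝ)) A (LieAlgd.tauDual F E) k}
      (hμ : LieAlgd.IsForm μ) :
      LieAlgd.differential
          (LieAlgd.pullback (LieAlgd.legendre I L) (LieAlgd.prolongLegendre A hL) μ) =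
        LieAlgd.pullback (LieAlgd.legendre I L) (LieAlgd.prolongLegendre A hL)
          (LieAlgd.differential μ) :=
    LieAlgd.differential_pullback_prolongMap (J := I.prod 𝓘(ℝ, F)) A hLeg hμ
      (LieAlgd.exists_eval_eq (F' := F) (E' := E) A)
  have hpull : LieAlgd.pullback (LieAlgd.legendre I L) (LieAlgd.prolongLegendre A hL)
      (LieAlgd.liouville A) = LieAlgd.poincareCartan A L := by
    funext a z
    exact (LieAlgd.legendre_eq A L a (z 0)).trans
      (congrArg (LieAlgd.poincareCartan A L a) (funext fun i => by rw [Subsingleton.elim i 0]))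
  refine ⟨⟨hLeg, fun X => X.contMDiff_fst, fun X => ?_, fun k μ hμ => hd hμ⟩, hpull, ?_⟩
  · exact (hLeg.contMDiff_tangentMap (m := ∞) (by simp)).comp X.contMDiff_snd
  · have h := hd (LieAlgd.isForm_liouville A)
    rw [hpull] at h
    change -LieAlgd.pullback (LieAlgd.legendre I L) (LieAlgd.prolongLegendre A hL)
      (LieAlgd.differential (LieAlgd.liouville A)) = -_
    rw [← h]
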